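/- Let $n\ge 2$ and let $(X,\omega)$ be a compact hermitian manifold of complex dimension $n$; here $\omega$ is the fundamental form of the metric, a smooth positive $(1,1)$-form. Write $d^c=\frac{i}{2}(\bar\partial-\partial)$, so that $dd^c=i\partial\bar\partial$, and for smooth $f:X\to\mathbb R$ put $$\Delta_\omega f=\frac{n\,dd^cf\wedge\omega^{n-1}}{\omega^n},\qquad |df|^2_\omega=\frac{n\,df\wedge d^cf\wedge\omega^{n-1}}{\omega^n},\qquad \mathrm{Vol}_\omega(X)=\int_X\omega^n .$$ Let $\Delta_\omega^*$ be the adjoint of $\Delta_\omega$ with respect to the $L^2$ inner product $\langle u,v\rangle=\int_X uv\,\omega^n$; thus a smooth function $\rho$ lies in $\ker\Delta_\omega^*$ if and only if $\int_X\rho\,\Delta_\omega f\,\omega^n=0$ for all smooth $f$. Let $B$, $C_S$, $C_P$ be real constants such that $$-B\,\omega^n\le dd^c\omega^{n-1}\le B\,\omega^n\quad\text{on }X,$$ $$\Big(\int_X|f|^{\frac{2n}{n-1}}\omega^n\Big)^{\frac{n-1}{n}}\le C_S\Big(\int_X|df|^2_\omega\,\omega^n+\int_X|f|^2\omega^n\Big)\quad\text{for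 all smooth } f:X\to\mathbb R,$$ $$\int_X|f|^2\omega^n\le C_P\int_X|df|^2_\omega\,\omega^n\quad\text{for all smooth } f:X\to\mathbb R\text{ with }\int_Xf\,\omega^n=0.$$ Then there is a constant $C_G$, depending only on $n$, $B$, $C_S$, $C_P$ and $\mathrm{Vol}_\omega(X)$, such that every smooth function $\rho\in\ker\Delta_\omega^*$ with $\inf_X\rho=1$ satisfies $$\sup_X\rho\le C_G .$$ -/

import Mathlib

open scoped Manifold ContDiff TensorProduct
open MeasureTheory

noncomputable section

namespace GauduchonFactor

/-! ### Alternating forms on a real vector space -/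

section Algebra

variable {V : Type*} [AddCommGroup V] [Module ℝ V] [TopologicalSpace V]

/-- The wedge product of alternating forms (shuffle convention, so that
`(α ∧ β) (u, v) = α u * β v - α v * β u` for `1`-forms), obtained from Mathlib's
`AlternatingMap.domCoprod`. -/
def wedge {k l : ℕ} (α : V [⋀^Fin k]→L[ℝ] ℝ) (β : V [⋀^Fin l]→L[ℝ] ℝ) :
    V [⋀^Fin (k + l)]→L[ℝ] ℝ :=
  let a : V [⋀^Fin (k + l)]→ₗ[ℝ] ℝ :=
    ((LinearMap.mul' ℝ ℝ).compAlternatingMap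
      (α.toAlternatingMap.domCoprod β.toAlternatingMap)).domDomCongr finSumFinEquiv
  { a with
    cont := by
      change Continuous fun v : Fin (k + l) → V => LinearMap.mul' ℝ ℝ
        ((α.toAlternatingMap.domCoprod β.toAlternatingMap) fun i => v (finSumFinEquiv i))
      simp only [AlternatingMap.domCoprod_apply, sum_apply, map_sum]
      refine continuous_finsetSum _ fun σ _ => ?_
      induction σ using Quotient.inductionOn' with
      | h σ =>
        rw [AlternatingMap.domCoprod.summand_mk'']
        change Continuous fun v : Fin (k + l) → V => LinearMap.mul' ℝ ℝ
          (((Equiv.Perm.sign σ : ℤˣ) : ℤ) •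
            ((α fun i => v (finSumFinEquiv (σ (Sum.inl i)))) ⊗ₜ[ℝ]
              (β fun i => v (finSumFinEquiv (σ (Sum.inr i))))))
        simp only [map_zsmul, LinearMap.mul'_apply]
        refine (Continuous.mul ?_ ?_).const_smul (Equiv.Perm.sign σ : ℤ)
        · exact α.coe_continuous.comp (continuous_pi fun i => continuous_apply _)
        · exact β.coe_continuous.comp (continuous_pi fun i => continuous_apply _) }

/-- The wedge powers `α ^ m` of a `2`-form. -/
def wedgePow (α : V [⋀^Fin 2]→L[ℝ] ℝ) : (m : ℕ) → V [⋀^Fin (2 * m)]→L[ℝ] ℝ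
  | 0 => ContinuousAlternatingMap.constOfIsEmpty ℝ V (Fin 0) 1
  | m + 1 => wedge (wedgePow α m) α

end Algebra

/-! ### The model space `ℂⁿ` -/

/-- The model space `ℂⁿ`. -/
abbrev Cn (n : ℕ) : Type := Fin n → ℂ

/-- The complex structure of `ℂⁿ`: multiplication by `i`, as a real linear map. -/
def cplxJ (n : ℕ) : Cn n →L[ℝ] Cn n := Complex.I • ContinuousLinearMap.id ℝ (Cn n)

/-- The first `k` vectors of the positively oriented real frame
`e₁, i e₁, e₂, i e₂, …, eₙ, i eₙ` of `ℂⁿ`. It is only used for `k = 2 n`. -/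
def stdFrame (n k : ℕ) : Fin k → Cn n := fun i j =>
  if (j : ℕ) = (i : ℕ) / 2 then (if (i : ℕ) % 2 = 0 then 1 else Complex.I) else 0

/-- The coefficient of a top degree form (`k = 2 n`) with respect to
`dx₁ ∧ dy₁ ∧ … ∧ dxₙ ∧ dyₙ`. -/
def topCoeff {n k : ℕ} (α : Cn n [⋀^Fin k]→L[ℝ] ℝ) : ℝ := α (stdFrame n k)

/-! ### Differential forms on a manifold modelled on `ℂⁿ` -/

section Forms

variable {n : ℕ} {X : Type*} [TopologicalSpace X] [ChartedSpace (Cn n) X]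

variable (n X) in
/-- Real differential `k`-forms (not necessarily smooth) on `X`: at each `x`, an alternating form
on the tangent space at `x`. As in Mathlib's `TangentSpace`, the tangent space at `x` is the model
space `ℂⁿ`, a vector being identified with its coordinates in the preferred chart `chartAt x`. -/
abbrev DForm (k : ℕ) : Type _ := X → Cn n [⋀^Fin k]→L[ℝ] ℝ

/-- The expression `(φ⁻¹)^* α` of a form in a chart `φ`; meaningful on `φ.target`. At `y = φ x` the
derivative of `φ⁻¹`, as a map to the tangent space at `x`, is the derivative of the change of
coordinates from `φ` to the preferred chart at `x`. -/
def DForm.inChart {k : ℕ} (α : DForm n X k) (φ : OpenPartialHomeomorph X (Cn n)) (y : Cn n) :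
    Cn n [⋀^Fin k]→L[ℝ] ℝ :=
  (α (φ.symm y)).compContinuousLinearMap
    (fderiv ℝ (fun z => chartAt (Cn n) (φ.symm y) (φ.symm z)) y)

/-- Smoothness of a form: all its chart expressions are smooth. -/
def DForm.IsSmooth {k : ℕ} (α : DForm n X k) : Prop :=
  ∀ φ ∈ atlas (Cn n) X, ContDiffOn ℝ ∞ (α.inChart φ) φ.target

/-- The value at `x` of a form of top degree, in the frame of `T_x X` given by `stdFrame`. Only
signs and quotients of two such values are used. -/
def DForm.coeffAt {k : ℕ} (α : DForm n X k) (x : X) : ℝ := topCoeff (α x)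

variable (n) in
/-- A function, as a `0`-form. -/
def ofFun (f : X → ℝ) : DForm n X 0 := fun x =>
  ContinuousAlternatingMap.constOfIsEmpty ℝ (Cn n) (Fin 0) (f x)

/-- The wedge product of differential forms. -/
def DForm.wedge {k l : ℕ} (α : DForm n X k) (β : DForm n X l) : DForm n X (k + l) :=
  fun x => GauduchonFactor.wedge (α x) (β x)

/-- The wedge powers of a differential `2`-form. -/
def DForm.pow (α : DForm n X 2) (m : ℕ) : DForm n X (2 * m) := fun x => wedgePow (α x) m

/-- The exterior derivative, computed at `x` in the preferred chart at `x` (whose derivative at `x`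
is the identification of the tangent space at `x` with `ℂⁿ`). -/
def DForm.d {k : ℕ} (α : DForm n X k) : DForm n X (k + 1) := fun x =>
  extDeriv (α.inChart (chartAt (Cn n) x)) (chartAt (Cn n) x x)

/-- Pullback `(v₁, …, vₖ) ↦ α (c J v₁, …, c J vₖ)` of a form by a real multiple of the complex
structure `J` of the tangent spaces. -/
def DForm.compJ {k : ℕ} (c : ℝ) (α : DForm n X k) : DForm n X k := fun x =>
  (α x).compContinuousLinearMap (c • cplxJ n)

/-- The twisted exterior derivative `d^c = (i/2)(∂̄ - ∂)`. On real forms this is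
`½ (J⁻¹)^* ∘ d ∘ J^*`, where `J⁻¹ = -J`: on forms of type `(p, q)` the operator `J^*` is
multiplication by `i ^ (p - q)`. -/
def DForm.dc {k : ℕ} (α : DForm n X k) : DForm n X (k + 1) := fun x =>
  (1 / 2 : ℝ) • ((α.compJ 1).d.compJ (-1)) x

/-- The operator `dd^c = i ∂∂̄`. -/
def DForm.ddc {k : ℕ} (α : DForm n X k) : DForm n X (k + 2) := α.dc.d

end Forms

/-! ### Hermitian metrics -/

/-- A hermitian metric on `X`, given by its fundamental form: a smooth positive
`(1,1)`-form. -/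
structure HermitianMetric (n : ℕ) (X : Type*) [TopologicalSpace X] [ChartedSpace (Cn n) X] where
  form : DForm n X 2
  smooth : form.IsSmooth
  invariant : ∀ (x : X) (u v : Cn n), form x ![cplxJ n u, cplxJ n v] = form x ![u, v]
  pos : ∀ (x : X) (u : Cn n), u ≠ 0 → 0 < form x ![u, cplxJ n u]

variable {n : ℕ} {X : Type*} [TopologicalSpace X] [ChartedSpace (Cn n) X]

variable (n) in
/-- Smooth real valued functions on `X`. -/
def IsSmoothFun (f : X → ℝ) : Prop := ContMDiff 𝓘(ℝ, Cn n) 𝓘(ℝ, ℝ) ∞ f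

namespace HermitianMetric

/-- The complex Laplacian `Δ_ω f = n dd^c f ∧ ω^{n-1} / ω^n`. -/
def laplacian (g : HermitianMetric n X) (f : X → ℝ) (x : X) : ℝ :=
  n * ((ofFun n f).ddc.wedge (g.form.pow (n - 1))).coeffAt x / (g.form.pow n).coeffAt x

/-- The squared norm of the gradient `|df|²_ω = n df ∧ d^c f ∧ ω^{n-1} / ω^n`. -/
def gradSq (g : HermitianMetric n X) (f : X → ℝ) (x : X) : ℝ :=
  n * (((ofFun n f).d.wedge (ofFun n f).dc).wedge (g.form.pow (n - 1))).coeffAt x /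
    (g.form.pow n).coeffAt x

/-- The pointwise inequality `-B ω^n ≤ dd^c ω^{n-1} ≤ B ω^n` between top degree forms. -/
def DdcBound (g : HermitianMetric n X) (B : ℝ) : Prop :=
  ∀ x : X, -B * (g.form.pow n).coeffAt x ≤ (g.form.pow (n - 1)).ddc.coeffAt x ∧
    (g.form.pow (n - 1)).ddc.coeffAt x ≤ B * (g.form.pow n).coeffAt x

variable [MeasurableSpace X]

/-- The measure `ω^n` on `X`. In each chart `φ` the top form `ω^n` gives the measure with density
its coefficient with respect to Lebesgue measure; transported to the domain of `φ`, these measures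
agree on overlaps, and the supremum of the family is the measure obtained by gluing them. -/
def volume (g : HermitianMetric n X) : Measure X :=
  ⨆ φ ∈ atlas (Cn n) X,
    (((MeasureTheory.volume : Measure (Cn n)).restrict φ.target).withDensity fun y =>
      ENNReal.ofReal (topCoeff ((g.form.pow n).inChart φ y))).map φ.symm

/-- `C` is a Sobolev constant: the inequality holds for all smooth functions, hence for the
completion `L²₁(X)` of the space of smooth functions on the compact manifold `X`. -/
def IsSobolevConstant (g : HermitianMetric n X) (C : ℝ) : Prop :=
  ∀ f : X → ℝ, IsSmoothFun n f →
    (∫ x, |f x| ^ (2 * (n : ℝ) / ((n : ℝ) - 1)) ∂g.volume) ^ (((n : ℝ) - 1) / (n : ℝ)) ≤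
      C * ((∫ x, g.gradSq f x ∂g.volume) + ∫ x, |f x| ^ 2 ∂g.volume)

/-- `C` is a Poincaré constant: the inequality holds for all smooth functions of mean zero, hence
for all functions of mean zero in the completion `L²₁(X)`. -/
def IsPoincareConstant (g : HermitianMetric n X) (C : ℝ) : Prop :=
  ∀ f : X → ℝ, IsSmoothFun n f → ∫ x, f x ∂g.volume = 0 →
    ∫ x, |f x| ^ 2 ∂g.volume ≤ C * ∫ x, g.gradSq f x ∂g.volume

/-- `ρ ∈ ker Δ_ω^*`, for the adjoint of `Δ_ω` with respect to the `L²` inner product of `ω^n`: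
`ρ` is smooth and `⟨ρ, Δ_ω f⟩ = 0` for all smooth `f`. -/
def InKerLaplacianAdjoint (g : HermitianMetric n X) (ρ : X → ℝ) : Prop :=
  IsSmoothFun n ρ ∧ ∀ f : X → ℝ, IsSmoothFun n f → ∫ x, ρ x * g.laplacian f x ∂g.volume = 0

end HermitianMetric

end GauduchonFactor

end

noncomputable section

namespace GauduchonFactor

/-! ### Antisymmetrization -/

section Antisymmetrization

variable {V : Type*}

/-! Write `w = log ρ - c` with `c` the mean of `log ρ`. Then `e^w` still lies in `ker Δ^*`, and it
suffices to bound `|w|` by a constant `M` of the permitted kind: the oscillation of `log ρ` is then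
at most `2 M`, and `inf ρ = 1` gives `ρ ≤ e^{2M}`.

Let `T = dd^c ω^{n-1} / ω^n`, so `|T| ≤ B`. Integration by parts gives `∫ Δf = n ∫ f T`
(`integral_laplacian`), and `f = 1` gives `∫ T = 0`. Testing the kernel condition with `F(w)`, where
`F' = p e^{(p-1)t}`, and subtracting from `Δ e^{pw}` leaves `p ∫ e^{pw} |dw|² = n ∫ (e^{pw} - c) T`
for every real `p` and `c` (`mul_integral_exp_mul_gradSq`). The right side is controlled by `B`
alone.

Small exponents use the Poincaré inequality. Apply it to `e^{pw/2} - m`, with `m` the mean of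
`e^{pw/2}`, and take `c = m²` in the energy identity. For the normalized moments `a(p) = V⁻¹ ∫
e^{pw}` this yields `a(p) ≤ a(p/2)² + K p² a(p)` (`integral_exp_le_sq`). Repeated halving reduces to
`p` near `0`, where `∫ w = 0` gives `a(p) = 1 + O(p²)`. The unknown constant in `O(p²)` is halved at
each stage and vanishes in the limit, so `a(p) ≤ e^{4Kp²}` as long as `K p² ≤ 1/2`
(`le_exp_of_le_sq_half`). This replaces a John–Nirenberg argument.

Large exponents use the Sobolev inequality for `e^{pw/2}` and the energy identity with `c = 0`. A
Moser iteration with ratio `χ = n/(n-1)` starts at a fixed small exponent and bounds `sup w`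
(`log_le_moserSum`, `mul_le_of_log_integral_exp_le`). Since `p` may have either sign, the same
argument bounds `sup (-w)` (`le_supBound`, `abs_le_supBound`).

Much of the file prepares `integral_laplacian`: wedge identities by antisymmetrization, Stokes in a
chart, positivity of `ω^n`, independence of the chart, and a partition of unity. -/

/-- The sum of `sign σ * F (v ∘ σ)` over all permutations `σ`. -/
def altSum {m : ℕ} (F : (Fin m → V) → ℝ) (v : Fin m → V) : ℝ :=
  ∑ σ : Equiv.Perm (Fin m), ((Equiv.Perm.sign σ : ℤ) : ℝ) * F (v ∘ σ)

theorem sign_mul_sign_self {m : ℕ} (τ : Equiv.Perm (Fin m)) :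
    ((Equiv.Perm.sign τ : ℤ) : ℝ) * ((Equiv.Perm.sign τ : ℤ) : ℝ) = 1 := by
  rcases Int.units_eq_one_or (Equiv.Perm.sign τ) with h | h <;> simp [h]

theorem altSum_comp_perm {m : ℕ} (F : (Fin m → V) → ℝ) (τ : Equiv.Perm (Fin m))
    (v : Fin m → V) :
    altSum (fun w => F (w ∘ τ)) v = ((Equiv.Perm.sign τ : ℤ) : ℝ) * altSum F v := by
  unfold altSum
  rw [← Equiv.sum_comp (Equiv.mulRight τ) (fun σ => ((Equiv.Perm.sign σ : ℤ) : ℝ) * F (v ∘ σ)),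
    Finset.mul_sum]
  refine Finset.sum_congr rfl fun σ _ => ?_
  have h := sign_mul_sign_self τ
  simp only [Equiv.coe_mulRight, Equiv.Perm.sign_mul, Units.val_mul, Int.cast_mul,
    Equiv.Perm.coe_mul, Function.comp_assoc]
  linear_combination (-((Equiv.Perm.sign σ : ℤ) : ℝ) * F (v ∘ σ ∘ τ)) * h

theorem altSum_mul_left {m : ℕ} (c : ℝ) (F : (Fin m → V) → ℝ) (v : Fin m → V) :
    altSum (fun w => c * F w) v = c * altSum F v := by
  simp only [altSum, Finset.mul_sum]
  exact Finset.sum_congr rfl fun σ _ => by ring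

theorem altSum_sum {ι : Type*} (s : Finset ι) {m : ℕ} (F : ι → (Fin m → V) → ℝ)
    (v : Fin m → V) : altSum (fun w => ∑ i ∈ s, F i w) v = ∑ i ∈ s, altSum (F i) v := by
  simp only [altSum, Finset.mul_sum]
  exact Finset.sum_comm

theorem altSum_cast {m m' : ℕ} (h : m = m') (F : (Fin m → V) → ℝ) (v : Fin m' → V) :
    altSum F (fun i => v (Fin.cast h i)) = altSum (fun w => F fun i => w (Fin.cast h i)) v := by
  subst h; rfl

/-- A permutation of part of the arguments extends to all of them with the same sign. Reindexing the
outer sum by it produces that sign a second time, so each of the `k!` inner terms contributes the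
full outer sum. -/
theorem altSum_absorb {k m : ℕ} (e : Equiv.Perm (Fin k) → Equiv.Perm (Fin m))
    (he : ∀ τ, Equiv.Perm.sign (e τ) = Equiv.Perm.sign τ) (F : (Fin m → V) → ℝ)
    (v : Fin m → V) :
    altSum (fun w => ∑ τ : Equiv.Perm (Fin k), ((Equiv.Perm.sign τ : ℤ) : ℝ) * F (w ∘ e τ)) v =
      (k.factorial : ℝ) * altSum F v := by
  rw [altSum_sum]
  have : ∀ τ ∈ (Finset.univ : Finset (Equiv.Perm (Fin k))),
      altSum (fun w => ((Equiv.Perm.sign τ : ℤ) : ℝ) * F (w ∘ e τ)) v = altSum F v := by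
    intro τ _
    rw [altSum_mul_left, altSum_comp_perm, he, ← mul_assoc, sign_mul_sign_self, one_mul]
  rw [Finset.sum_congr rfl this]
  simp [Finset.card_univ, Fintype.card_perm]

theorem altSum_absorb_castAdd {k l : ℕ} (F : (Fin k → V) → ℝ) (G : (Fin l → V) → ℝ)
    (v : Fin (k + l) → V) :
    altSum (fun w => altSum F (fun i => w (Fin.castAdd l i)) * G fun i => w (Fin.natAdd k i)) v =
      (k.factorial : ℝ) *
        altSum (fun w => F (fun i => w (Fin.castAdd l i)) * G fun i => w (Fin.natAdd k i)) v := by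
  rw [← altSum_absorb (fun τ => finSumFinEquiv.permCongr (Equiv.Perm.sumCongr τ 1))
    (fun τ => by simp)]
  congr 1
  funext w
  rw [altSum, Finset.sum_mul]
  refine Finset.sum_congr rfl fun τ _ => ?_
  simp [Function.comp_def, mul_assoc, Equiv.permCongr_apply]

theorem altSum_absorb_natAdd {k l : ℕ} (F : (Fin k → V) → ℝ) (G : (Fin l → V) → ℝ)
    (v : Fin (k + l) → V) :
    altSum (fun w => F (fun i => w (Fin.castAdd l i)) * altSum G fun i => w (Fin.natAdd k i)) v =
      (l.factorial : ℝ) *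
        altSum (fun w => F (fun i => w (Fin.castAdd l i)) * G fun i => w (Fin.natAdd k i)) v := by
  rw [← altSum_absorb (fun τ => finSumFinEquiv.permCongr (Equiv.Perm.sumCongr 1 τ))
    (fun τ => by simp)]
  congr 1
  funext w
  rw [altSum, Finset.mul_sum]
  refine Finset.sum_congr rfl fun τ _ => ?_
  simp [Function.comp_def, Equiv.permCongr_apply, mul_left_comm]

theorem altSum_absorb_succ {k : ℕ} (F : V → (Fin k → V) → ℝ) (v : Fin (k + 1) → V) :
    altSum (fun w => altSum (F (w 0)) fun i => w i.succ) v =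
      (k.factorial : ℝ) * altSum (fun w => F (w 0) fun i => w i.succ) v := by
  rw [← altSum_absorb (fun τ => Equiv.Perm.decomposeFin.symm (0, τ))
    (fun τ => by simp [Equiv.Perm.decomposeFin.symm_sign])]
  congr 1

end Antisymmetrization

/-! ### Wedge products as antisymmetrized sums, and the algebra behind the Leibniz rule. -/

section WedgeAlgebra

variable {V : Type*} [NormedAddCommGroup V] [NormedSpace ℝ V]

theorem map_comp_perm {k : ℕ} (α : V [⋀^Fin k]→L[ℝ] ℝ) (v : Fin k → V)
    (σ : Equiv.Perm (Fin k)) : α (v ∘ σ) = Equiv.Perm.sign σ • α v :=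
  α.toAlternatingMap.map_perm v σ

/-- Replaces the sum over shuffles by a sum over all permutations, each shuffle being counted `k!
l!` times. Wedge identities then become reindexings of `altSum`, followed by cancellation of
factorials. -/
theorem factorial_mul_wedge_apply {k l : ℕ} (α : V [⋀^Fin k]→L[ℝ] ℝ) (β : V [⋀^Fin l]→L[ℝ] ℝ)
    (v : Fin (k + l) → V) :
    (k.factorial : ℝ) * l.factorial * wedge α β v =
      altSum (fun w => α (fun i => w (Fin.castAdd l i)) * β fun i => w (Fin.natAdd k i)) v := by
  have h := MultilinearMap.domCoprod_alternization_eq α.toAlternatingMap β.toAlternatingMap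
  have h1 := congrArg (fun f => LinearMap.mul' ℝ ℝ (f fun i => v (finSumFinEquiv i))) h
  simp only [Fintype.card_fin, AlternatingMap.smul_apply, map_nsmul] at h1
  have h2 : wedge α β v = LinearMap.mul' ℝ ℝ ((α.toAlternatingMap.domCoprod β.toAlternatingMap)
      fun i => v (finSumFinEquiv i)) := rfl
  rw [h2, ← Nat.cast_mul, ← nsmul_eq_mul, ← h1, MultilinearMap.alternatization_apply, map_sum,
    altSum, ← Equiv.sum_comp finSumFinEquiv.permCongr]
  refine Finset.sum_congr rfl fun σ _ => ?_
  rw [Equiv.Perm.sign_permCongr, Units.smul_def, map_zsmul, zsmul_eq_mul]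
  congr 1
  simp [MultilinearMap.domDomCongr_apply, MultilinearMap.domCoprod_apply, Equiv.permCongr_apply]

/-- Permutations of `k + 1` letters are sorted by the image `p` of `0`. The remaining `k!` choices
all give the same term because the form is already alternating. -/
theorem factorial_mul_alternatizeUncurryFin_apply {k : ℕ} (A : V →L[ℝ] V [⋀^Fin k]→L[ℝ] ℝ)
    (v : Fin (k + 1) → V) :
    (k.factorial : ℝ) * ContinuousAlternatingMap.alternatizeUncurryFin A v =
      altSum (fun w => A (w 0) fun i => w i.succ) v := by
  rw [ContinuousAlternatingMap.alternatizeUncurryFin_apply, altSum, Finset.univ_perm_fin_succ,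
    ← Finset.univ_product_univ]
  simp only [Finset.sum_map, Equiv.toEmbedding_apply, Finset.sum_product, Finset.mul_sum]
  refine Finset.sum_congr rfl fun p _ => ?_
  have key : ∀ τ : Equiv.Perm (Fin k),
      ((Equiv.Perm.sign (Equiv.Perm.decomposeFin.symm (p, τ)) : ℤ) : ℝ) *
        A ((v ∘ (Equiv.Perm.decomposeFin.symm (p, τ))) 0)
          (fun i => (v ∘ (Equiv.Perm.decomposeFin.symm (p, τ))) i.succ) =
      (-1) ^ (p : ℕ) • A (v p) (p.removeNth v) := by
    intro τ
    have h1 : (fun i : Fin k => (v ∘ (Equiv.Perm.decomposeFin.symm (p, τ))) i.succ) =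
        (fun i => v (Equiv.swap 0 p i.succ)) ∘ τ := by
      funext i; simp
    rw [h1, Function.comp_apply, Equiv.Perm.decomposeFin_symm_apply_zero,
      map_comp_perm, Equiv.Perm.decomposeFin.symm_sign]
    have hs := sign_mul_sign_self τ
    induction p using Fin.cases with
    | zero =>
      simp only [if_true, one_mul, Equiv.swap_self, Units.smul_def, zsmul_eq_mul, ← mul_assoc, hs]
      simp [Fin.tail_def]
    -- The swap of `0` and `p` differs from deletion of the entry `p` by the cycle `i.cycleRange` of
    -- sign `(-1)^i`; the swap itself supplies the missing `-1`.
    | succ i =>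
      have h2 : (fun j : Fin k => v (Equiv.swap 0 i.succ j.succ)) =
          (i.succ.removeNth v) ∘ i.cycleRange := by
        funext j
        simp [Fin.removeNth, Fin.succAbove_cycleRange]
      rw [h2, map_comp_perm, if_neg (Fin.succ_ne_zero i), Fin.sign_cycleRange]
      simp only [Units.smul_def, zsmul_eq_mul, Units.val_mul, Int.cast_mul, Units.val_neg,
        Units.val_one, Int.cast_neg, Int.cast_one, Units.val_pow_eq_pow_val, Int.cast_pow,
        Fin.val_succ, pow_succ]
      linear_combination (-(-1 : ℝ) ^ (i : ℕ) * A (v i.succ) (i.succ.removeNth v)) * hs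
  rw [Finset.sum_congr rfl fun τ _ => key τ]
  simp [Finset.card_univ, Fintype.card_perm]

theorem wedge_eq_iff {k l : ℕ} (α : V [⋀^Fin k]→L[ℝ] ℝ) (β : V [⋀^Fin l]→L[ℝ] ℝ)
    (v : Fin (k + l) → V) (c : ℝ) :
    wedge α β v = c ↔
      altSum (fun w => α (fun i => w (Fin.castAdd l i)) * β fun i => w (Fin.natAdd k i)) v =
        (k.factorial : ℝ) * l.factorial * c := by
  rw [← factorial_mul_wedge_apply]
  have h : (k.factorial : ℝ) * l.factorial ≠ 0 := by positivity
  exact ⟨fun h' => by rw [h'], fun h' => mul_left_cancel₀ h h'⟩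

theorem wedge_compContinuousLinearMap {W : Type*} [NormedAddCommGroup W] [NormedSpace ℝ W]
    {k l : ℕ} (α : V [⋀^Fin k]→L[ℝ] ℝ) (β : V [⋀^Fin l]→L[ℝ] ℝ) (L : W →L[ℝ] V) :
    wedge (α.compContinuousLinearMap L) (β.compContinuousLinearMap L) =
      (wedge α β).compContinuousLinearMap L := by
  ext v
  rw [wedge_eq_iff, ContinuousAlternatingMap.compContinuousLinearMap_apply,
    factorial_mul_wedge_apply]
  rfl

theorem wedgePow_compContinuousLinearMap {W : Type*} [NormedAddCommGroup W] [NormedSpace ℝ W]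
    (α : V [⋀^Fin 2]→L[ℝ] ℝ) (L : W →L[ℝ] V) (m : ℕ) :
    wedgePow (α.compContinuousLinearMap L) m = (wedgePow α m).compContinuousLinearMap L := by
  induction m with
  | zero => ext v; rfl
  | succ m ih => rw [wedgePow, ih, wedge_compContinuousLinearMap]; rfl

theorem norm_wedge_apply_le {k l : ℕ} (α : V [⋀^Fin k]→L[ℝ] ℝ) (β : V [⋀^Fin l]→L[ℝ] ℝ)
    (v : Fin (k + l) → V) :
    ‖wedge α β v‖ ≤ (k + l).factorial * ‖α‖ * ‖β‖ * ∏ i, ‖v i‖ := by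
  have h1 : ‖altSum (fun w => α (fun i => w (Fin.castAdd l i)) * β fun i => w (Fin.natAdd k i)) v‖
      ≤ (k + l).factorial * (‖α‖ * ‖β‖ * ∏ i, ‖v i‖) := by
    refine (norm_sum_le _ _).trans ((Finset.sum_le_card_nsmul _ _ (‖α‖ * ‖β‖ * ∏ i, ‖v i‖)
      fun σ _ => ?_).trans (by simp [Finset.card_univ, Fintype.card_perm]))
    have hs : ‖((Equiv.Perm.sign σ : ℤ) : ℝ)‖ = 1 := by
      rcases Int.units_eq_one_or (Equiv.Perm.sign σ) with h | h <;> simp [h]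
    rw [norm_mul, hs, one_mul, norm_mul, ← Equiv.prod_comp σ, Fin.prod_univ_add]
    calc _ ≤ (‖α‖ * ∏ i, ‖v (σ (Fin.castAdd l i))‖) * (‖β‖ * ∏ i, ‖v (σ (Fin.natAdd k i))‖) :=
          mul_le_mul (α.le_opNorm _) (β.le_opNorm _) (norm_nonneg _) (by positivity)
      _ = _ := by ring
  rw [← factorial_mul_wedge_apply, norm_mul, norm_mul, Real.norm_natCast,
    Real.norm_natCast] at h1
  have h2 : (1 : ℝ) ≤ (k.factorial : ℝ) * l.factorial := by
    exact_mod_cast Nat.one_le_iff_ne_zero.2 (by positivity)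
  nlinarith [norm_nonneg (wedge α β v)]

theorem wedge_add_left {k l : ℕ} (α α' : V [⋀^Fin k]→L[ℝ] ℝ) (β : V [⋀^Fin l]→L[ℝ] ℝ) :
    wedge (α + α') β = wedge α β + wedge α' β := by
  ext v
  rw [wedge_eq_iff, ContinuousAlternatingMap.add_apply, mul_add, factorial_mul_wedge_apply,
    factorial_mul_wedge_apply]
  simp [altSum, add_mul, mul_add, Finset.sum_add_distrib]

theorem wedge_add_right {k l : ℕ} (α : V [⋀^Fin k]→L[ℝ] ℝ) (β β' : V [⋀^Fin l]→L[ℝ] ℝ) :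
    wedge α (β + β') = wedge α β + wedge α β' := by
  ext v
  rw [wedge_eq_iff, ContinuousAlternatingMap.add_apply, mul_add, factorial_mul_wedge_apply,
    factorial_mul_wedge_apply]
  simp [altSum, mul_add, Finset.sum_add_distrib]

theorem wedge_smul_left {k l : ℕ} (c : ℝ) (α : V [⋀^Fin k]→L[ℝ] ℝ) (β : V [⋀^Fin l]→L[ℝ] ℝ) :
    wedge (c • α) β = c • wedge α β := by
  ext v
  rw [wedge_eq_iff, ContinuousAlternatingMap.smul_apply, smul_eq_mul, mul_left_comm,
    factorial_mul_wedge_apply, ← altSum_mul_left]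
  simp [mul_assoc]

theorem wedge_smul_right {k l : ℕ} (c : ℝ) (α : V [⋀^Fin k]→L[ℝ] ℝ) (β : V [⋀^Fin l]→L[ℝ] ℝ) :
    wedge α (c • β) = c • wedge α β := by
  ext v
  rw [wedge_eq_iff, ContinuousAlternatingMap.smul_apply, smul_eq_mul, mul_left_comm,
    factorial_mul_wedge_apply, ← altSum_mul_left]
  simp [mul_left_comm]

variable (V) in
/-- The wedge product as a continuous bilinear map. -/
def wedgeL (k l : ℕ) :
    (V [⋀^Fin k]→L[ℝ] ℝ) →L[ℝ] (V [⋀^Fin l]→L[ℝ] ℝ) →L[ℝ] V [⋀^Fin (k + l)]→L[ℝ] ℝ :=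
  LinearMap.mkContinuous₂
    (LinearMap.mk₂ ℝ wedge wedge_add_left wedge_smul_left wedge_add_right wedge_smul_right)
    (k + l).factorial fun α β =>
      ContinuousAlternatingMap.opNorm_le_bound _ (by positivity) (norm_wedge_apply_le α β)

@[simp]
theorem wedgeL_apply {k l : ℕ} (α : V [⋀^Fin k]→L[ℝ] ℝ) (β : V [⋀^Fin l]→L[ℝ] ℝ) :
    wedgeL V k l α β = wedge α β := rfl

/-- The identity `λ ∧ (α ∧ β) = (λ ∧ α) ∧ β`, extended linearly in `λ ⊗ α`. -/
theorem alternatizeUncurryFin_wedge_left {k l : ℕ} (A : V →L[ℝ] V [⋀^Fin k]→L[ℝ] ℝ)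
    (β : V [⋀^Fin l]→L[ℝ] ℝ) (v : Fin (k + 1 + l) → V) :
    ContinuousAlternatingMap.alternatizeUncurryFin (((wedgeL V k l).flip β).comp A)
        (fun i => v (Fin.cast (by omega) i)) =
      wedge (ContinuousAlternatingMap.alternatizeUncurryFin A) β v := by
  refine Eq.symm ((wedge_eq_iff _ _ _ _).2 ?_)
  have hk : (k.factorial : ℝ) ≠ 0 := by positivity
  have hkl : ((k + l).factorial : ℝ) ≠ 0 := by positivity
  have hk1 : ((k + 1).factorial : ℝ) ≠ 0 := by positivity
  have hl : (l.factorial : ℝ) ≠ 0 := by positivity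
  have hL : (k.factorial : ℝ) * l.factorial * ContinuousAlternatingMap.alternatizeUncurryFin
      (((wedgeL V k l).flip β).comp A) (fun i => v (Fin.cast (by omega) i)) =
      altSum (fun w : Fin (k + l + 1) → V => A (w 0) (fun i => w (Fin.castAdd l i).succ) *
        β fun i => w (Fin.natAdd k i).succ) (fun i => v (Fin.cast (by omega) i)) := by
    apply mul_left_cancel₀ hkl
    rw [← altSum_absorb_succ (fun u w => A u (fun i => w (Fin.castAdd l i)) *
      β fun i => w (Fin.natAdd k i)), mul_left_comm, factorial_mul_alternatizeUncurryFin_apply,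
      ← altSum_mul_left]
    congr 1
    funext w
    exact factorial_mul_wedge_apply _ _ _
  have hR : (k.factorial : ℝ) * altSum (fun w : Fin (k + 1 + l) → V =>
      ContinuousAlternatingMap.alternatizeUncurryFin A (fun i => w (Fin.castAdd l i)) *
        β fun i => w (Fin.natAdd (k + 1) i)) v = (k + 1).factorial *
      altSum (fun w : Fin (k + 1 + l) → V => (A (w (Fin.castAdd l 0)) fun i =>
        w (Fin.castAdd l i.succ)) * β fun i => w (Fin.natAdd (k + 1) i)) v := by
    rw [← altSum_absorb_castAdd (fun w => A (w 0) fun i => w i.succ) β, ← altSum_mul_left]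
    congr 1
    funext w
    rw [← mul_assoc, factorial_mul_alternatizeUncurryFin_apply]
  apply mul_left_cancel₀ hk
  rw [hR, mul_assoc ((k + 1).factorial : ℝ), mul_left_comm (k.factorial : ℝ), ← mul_assoc
    (k.factorial : ℝ), hL, altSum_cast]
  congr 3
  funext w
  congr 2
  · funext i
    congr 1
    ext
    simp
    omega

/-- The identity `μ ∧ (λ ∧ β) = -λ ∧ (μ ∧ β)` for `1`-forms, extended linearly in `μ ⊗ β`. -/
theorem alternatizeUncurryFin_wedge_right {l : ℕ} (α : V [⋀^Fin 1]→L[ℝ] ℝ)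
    (B : V →L[ℝ] V [⋀^Fin l]→L[ℝ] ℝ) (v : Fin (1 + (l + 1)) → V) :
    ContinuousAlternatingMap.alternatizeUncurryFin ((wedgeL V 1 l α).comp B)
        (fun i => v (Fin.cast (by omega) i)) =
      -wedge α (ContinuousAlternatingMap.alternatizeUncurryFin B) v := by
  have hkl : ((1 + l).factorial : ℝ) ≠ 0 := by positivity
  have hl : (l.factorial : ℝ) ≠ 0 := by positivity
  have hl1 : ((l + 1).factorial : ℝ) ≠ 0 := by positivity
  have hL : (l.factorial : ℝ) * ContinuousAlternatingMap.alternatizeUncurryFin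
      ((wedgeL V 1 l α).comp B) (fun i => v (Fin.cast (by omega) i)) =
      altSum (fun w : Fin (1 + l + 1) → V => α (fun i => w (Fin.castAdd l i).succ) *
        B (w 0) fun i => w (Fin.natAdd 1 i).succ) (fun i => v (Fin.cast (by omega) i)) := by
    apply mul_left_cancel₀ hkl
    rw [← altSum_absorb_succ (fun u w => α (fun i => w (Fin.castAdd l i)) *
      B u fun i => w (Fin.natAdd 1 i)), mul_left_comm, factorial_mul_alternatizeUncurryFin_apply,
      ← altSum_mul_left]
    congr 1
    funext w
    simpa using factorial_mul_wedge_apply α (B (w 0)) (fun i => w i.succ)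
  have hR : (l.factorial : ℝ) * wedge α (ContinuousAlternatingMap.alternatizeUncurryFin B) v =
      altSum (fun w : Fin (1 + (l + 1)) → V => α (fun i => w (Fin.castAdd (l + 1) i)) *
        B (w (Fin.natAdd 1 0)) fun i => w (Fin.natAdd 1 i.succ)) v := by
    have h := factorial_mul_wedge_apply α (ContinuousAlternatingMap.alternatizeUncurryFin B) v
    apply mul_left_cancel₀ hl1
    rw [← altSum_absorb_natAdd α (fun w => B (w 0) fun i => w i.succ), mul_left_comm]
    simp only [Nat.factorial_one, Nat.cast_one, one_mul] at h
    rw [h, ← altSum_mul_left]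
    congr 1
    funext w
    rw [mul_left_comm, factorial_mul_alternatizeUncurryFin_apply]
  apply mul_left_cancel₀ hl
  rw [hL, mul_neg, hR, altSum_cast]
  have h01 : (⟨0, by omega⟩ : Fin (1 + (l + 1))) ≠ ⟨1, by omega⟩ := by simp
  rw [eq_neg_iff_add_eq_zero, ← eq_neg_iff_add_eq_zero, ← neg_one_mul]
  -- The two integrands differ only in which of the first two arguments goes to `α` and which to
  -- `B`; this transposition is the source of the sign.
  have := altSum_comp_perm (fun w : Fin (1 + (l + 1)) → V =>
    α (fun i => w (Fin.castAdd (l + 1) i)) *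
        B (w (Fin.natAdd 1 0)) fun i => w (Fin.natAdd 1 i.succ))
    (Equiv.swap ⟨0, by omega⟩ ⟨1, by omega⟩) v
  rw [Equiv.Perm.sign_swap h01] at this
  simp only [Units.val_neg, Units.val_one, Int.cast_neg, Int.cast_one] at this
  rw [← this]
  congr 1
  funext w
  have e0 : ∀ i : Fin 1, Equiv.swap (⟨0, by omega⟩ : Fin (1 + (l + 1))) ⟨1, by omega⟩
      (Fin.castAdd (l + 1) i) = Fin.cast (by omega) (Fin.castAdd l i).succ := by
    intro i
    have : i = 0 := Subsingleton.elim _ _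
    subst this
    exact Equiv.swap_apply_left _ _
  have e1 : Equiv.swap (⟨0, by omega⟩ : Fin (1 + (l + 1))) ⟨1, by omega⟩
      (Fin.natAdd 1 0) = Fin.cast (by omega) (0 : Fin (1 + l + 1)) :=
    Equiv.swap_apply_right _ _
  have e2 : ∀ i : Fin l, Equiv.swap (⟨0, by omega⟩ : Fin (1 + (l + 1))) ⟨1, by omega⟩
      (Fin.natAdd 1 i.succ) = Fin.cast (by omega) (Fin.natAdd 1 i).succ := by
    intro i
    rw [Equiv.swap_apply_of_ne_of_ne]
    · ext; simp; omega
    · simp [Fin.ext_iff]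
    · simp [Fin.ext_iff]
  simp only [Function.comp_apply, e0, e1, e2]

/-- The term `df ∧ β` of `d(f β)`, with `lam` the derivative of `f`. -/
theorem alternatizeUncurryFin_smulRight {l : ℕ} (lam : V →L[ℝ] ℝ) (α : V [⋀^Fin 1]→L[ℝ] ℝ)
    (hα : ∀ w, α w = lam (w 0)) (β : V [⋀^Fin l]→L[ℝ] ℝ) (v : Fin (1 + l) → V) :
    ContinuousAlternatingMap.alternatizeUncurryFin (lam.smulRight β)
        (fun i => v (Fin.cast (by omega) i)) = wedge α β v := by
  refine Eq.symm ((wedge_eq_iff _ _ _ _).2 ?_)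
  rw [Nat.factorial_one, Nat.cast_one, one_mul, factorial_mul_alternatizeUncurryFin_apply,
    altSum_cast]
  congr 1
  funext w
  rw [hα]
  simp only [ContinuousLinearMap.smulRight_apply, ContinuousAlternatingMap.smul_apply, smul_eq_mul]
  congr 2
  funext i
  congr 1
  ext
  simp
  omega

end WedgeAlgebra

/-! ### Top degree forms on `ℂⁿ` -/

section TopDegree

/-- The bijection `(i, a) ↦ 2 i + a`. -/
def pairEquiv (n : ℕ) : Fin n × Fin 2 ≃ Fin (2 * n) :=
  finProdFinEquiv.trans (finCongr (mul_comm n 2))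

theorem pairEquiv_val {n : ℕ} (p : Fin n × Fin 2) : (pairEquiv n p : ℕ) = p.2 + 2 * p.1 := rfl

/-- The real basis `e₁, i e₁, …, eₙ, i eₙ` of `ℂⁿ`. -/
def stdBasis (n : ℕ) : Module.Basis (Fin (2 * n)) ℝ (Cn n) :=
  (Pi.basis fun _ : Fin n => Complex.basisOneI).reindex
    ((Equiv.sigmaEquivProd (Fin n) (Fin 2)).trans (pairEquiv n))

theorem stdFrame_pairEquiv {n : ℕ} (p : Fin n × Fin 2) :
    stdFrame n (2 * n) (pairEquiv n p) = Pi.single p.1 (Complex.basisOneI p.2) := by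
  obtain ⟨i, a⟩ := p
  funext j
  have h1 : (pairEquiv n (i, a) : ℕ) / 2 = i := by rw [pairEquiv_val]; simp only; omega
  have h2 : (pairEquiv n (i, a) : ℕ) % 2 = a := by rw [pairEquiv_val]; simp only; omega
  simp only [stdFrame, h1, h2, Pi.single_apply, Fin.ext_iff]
  split_ifs with h3 h4
  · have : a = 0 := Fin.ext h4
    simp [this]
  · have : a = 1 := by omega
    simp [this]
  · rfl

theorem coe_stdBasis (n : ℕ) : ⇑(stdBasis n) = stdFrame n (2 * n) := by
  funext c
  obtain ⟨p, rfl⟩ := (pairEquiv n).surjective c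
  rw [stdFrame_pairEquiv, stdBasis, Module.Basis.reindex_apply]
  simp [Pi.basis_apply]

/-- Forms of top degree are multiples of the determinant of the basis `stdBasis`. -/
theorem map_comp_stdFrame {n k : ℕ} (hk : k = 2 * n) (α : Cn n [⋀^Fin k]→L[ℝ] ℝ)
    (L : Cn n →ₗ[ℝ] Cn n) :
    α (fun i => L (stdFrame n k i)) = LinearMap.det L * α (stdFrame n k) := by
  subst hk
  have h := AlternatingMap.eq_smul_basis_det (stdBasis n) α.toAlternatingMap
  have h' : ∀ v, α v = α (stdBasis n) * (stdBasis n).det v := fun v => by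
    have := congrArg (fun f => f v) h
    simpa using this
  rw [← coe_stdBasis, h', mul_comm]
  congr 1
  have := (stdBasis n).det_comp L (stdBasis n)
  simpa [Module.Basis.det_self, Function.comp_def] using this

theorem topCoeff_compContinuousLinearMap {n k : ℕ} (hk : k = 2 * n)
    (α : Cn n [⋀^Fin k]→L[ℝ] ℝ) (L : Cn n →L[ℝ] Cn n) :
    topCoeff (α.compContinuousLinearMap L) = LinearMap.det (L : Cn n →ₗ[ℝ] Cn n) * topCoeff α :=
  map_comp_stdFrame hk α L

/-- Source of every orientation statement below: complex linear maps never reverse the real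
orientation. -/
theorem det_restrictScalars_eq_normSq {n : ℕ} (L : Cn n →ₗ[ℂ] Cn n) :
    LinearMap.det (L.restrictScalars ℝ) = Complex.normSq (LinearMap.det L) := by
  rw [LinearMap.det_restrictScalars, Algebra.norm_complex_apply]

theorem det_cplxJ (n : ℕ) : LinearMap.det (cplxJ n : Cn n →ₗ[ℝ] Cn n) = 1 := by
  have h : (cplxJ n : Cn n →ₗ[ℝ] Cn n) =
      (Complex.I • (LinearMap.id : Cn n →ₗ[ℂ] Cn n)).restrictScalars ℝ := by
    ext v; rfl
  rw [h, det_restrictScalars_eq_normSq, LinearMap.det_smul]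
  simp

theorem cplxJ_apply {n : ℕ} (u : Cn n) : cplxJ n u = Complex.I • u := rfl

end TopDegree

/-! ### Positivity of the top power of a positive `(1,1)`-form -/

section Positivity

theorem exists_wedgePow_eq_altSum {V : Type*} [NormedAddCommGroup V] [NormedSpace ℝ V]
    (η : V [⋀^Fin 2]→L[ℝ] ℝ) (b : V → V → ℝ) (hb : ∀ w, η w = b (w 0) (w 1) - b (w 1) (w 0))
    (m : ℕ) : ∃ c : ℝ, 0 < c ∧ ∀ v, wedgePow η m v =
      c * altSum (fun w => ∏ i : Fin m, b (w ⟨2 * i, by omega⟩) (w ⟨2 * i + 1, by omega⟩)) v := by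
  induction m with
  | zero => exact ⟨1, one_pos, fun v => by simp [altSum, wedgePow]⟩
  | succ m ih =>
    obtain ⟨c, hc, ih⟩ := ih
    have hη : ∀ w, η w = altSum (fun w : Fin 2 → V => b (w 0) (w 1)) w := by
      intro w
      have h2 : (Finset.univ : Finset (Equiv.Perm (Fin 2))) = {1, Equiv.swap 0 1} := by decide
      have h3 : (1 : Equiv.Perm (Fin 2)) ≠ Equiv.swap 0 1 := by decide
      rw [hb, altSum, h2, Finset.sum_pair h3, Equiv.Perm.sign_swap (by simp)]
      simp [sub_eq_add_neg]
    refine ⟨c, hc, fun v => ?_⟩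
    change wedge (wedgePow η m) η v = _
    rw [wedge_eq_iff]
    simp_rw [ih, hη, mul_assoc c]
    rw [altSum_mul_left, altSum_absorb_castAdd
      (fun w => ∏ i : Fin m, b (w ⟨2 * i, by omega⟩) (w ⟨2 * i + 1, by omega⟩)),
      altSum_absorb_natAdd (fun w : Fin (2 * m) → V =>
        ∏ i : Fin m, b (w ⟨2 * i, by omega⟩) (w ⟨2 * i + 1, by omega⟩))]
    have : (altSum fun w : Fin (2 * m + 2) → V =>
        (∏ i : Fin m, b (w (Fin.castAdd 2 ⟨2 * i, by omega⟩))
          (w (Fin.castAdd 2 ⟨2 * i + 1, by omega⟩))) *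
        b (w (Fin.natAdd (2 * m) 0)) (w (Fin.natAdd (2 * m) 1))) v =
        (altSum fun w : Fin (2 * (m + 1)) → V => ∏ i : Fin (m + 1),
          b (w ⟨2 * i, by omega⟩) (w ⟨2 * i + 1, by omega⟩)) v := by
      congr 1
      funext w
      rw [Fin.prod_univ_castSucc]
      rfl
    rw [this]
    ring

/-- The model case, where the hermitian structure is standard. Only the sign matters, so it is
enough that the antisymmetrized sum is a sum of squares with one nonzero term. -/
theorem wedgePow_stdFrame_pos {n : ℕ} (η : Cn n [⋀^Fin 2]→L[ℝ] ℝ)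
    (hη : ∀ w, η w = ∑ k, ((w 0 k).re * (w 1 k).im - (w 1 k).re * (w 0 k).im)) :
    0 < topCoeff (wedgePow η n) := by
  obtain ⟨c, hc, h⟩ := exists_wedgePow_eq_altSum η (fun u w => ∑ k, (u k).re * (w k).im)
    (fun w => by rw [hη, Finset.sum_sub_distrib]) n
  rw [topCoeff, h]
  refine mul_pos hc ?_
  simp_rw [Finset.prod_univ_sum]
  rw [altSum_sum]
  -- For a choice `κ` of one summand in each factor, the antisymmetrization is the Leibniz formula
  -- for `det (P ⊗ 1₂) = (det P)²`, with `P` the 0-1 matrix of `κ`. The choice `κ = id` contributes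
  -- `1`.
  have key : ∀ κ : Fin n → Fin n,
      altSum (fun w : Fin (2 * n) → Cn n => ∏ i : Fin n,
        ((w ⟨2 * i, by omega⟩ (κ i)).re * (w ⟨2 * i + 1, by omega⟩ (κ i)).im))
        (stdFrame n (2 * n)) =
      (Matrix.of fun j i => if κ i = j then (1 : ℝ) else 0).det ^ 2 := by
    intro κ
    let P : Matrix (Fin n) (Fin n) ℝ := Matrix.of fun j i => if κ i = j then (1 : ℝ) else 0
    have h1 : (Matrix.kroneckerMap (· * ·) P (1 : Matrix (Fin 2) (Fin 2) ℝ)).det = P.det ^ 2 := by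
      rw [Matrix.det_kronecker]; simp
    rw [← h1, ← Matrix.det_submatrix_equiv_self (pairEquiv n).symm, Matrix.det_apply', altSum]
    refine Finset.sum_congr rfl fun σ _ => ?_
    congr 1
    rw [← Equiv.prod_comp (pairEquiv n), Fintype.prod_prod_type]
    refine Finset.prod_congr rfl fun i _ => ?_
    rw [Fin.prod_univ_two]
    have e0 : (⟨2 * i, by omega⟩ : Fin (2 * n)) = pairEquiv n (i, 0) := by
      ext; simp [pairEquiv_val]
    have e1 : (⟨2 * i + 1, by omega⟩ : Fin (2 * n)) = pairEquiv n (i, 1) := by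
      ext; simp [pairEquiv_val, add_comm]
    rw [e0, e1]
    simp only [Function.comp_apply]
    generalize σ (pairEquiv n (i, 0)) = s
    generalize σ (pairEquiv n (i, 1)) = t
    obtain ⟨⟨s, a⟩, rfl⟩ := (pairEquiv n).surjective s
    obtain ⟨⟨t, b⟩, rfl⟩ := (pairEquiv n).surjective t
    rw [stdFrame_pairEquiv, stdFrame_pairEquiv]
    simp only [Matrix.submatrix_apply, Equiv.symm_apply_apply, Matrix.kroneckerMap_apply, P,
      Matrix.of_apply, Matrix.one_apply, Pi.single_apply]
    congr 1
    · fin_cases a <;> split_ifs <;> simp_all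
    · fin_cases b <;> split_ifs <;> simp_all
  simp_rw [key]
  refine lt_of_lt_of_le one_pos ((le_of_eq ?_).trans (Finset.single_le_sum
    (fun κ _ => sq_nonneg _) (Finset.mem_univ (id : Fin n → Fin n))))
  have : (Matrix.of fun j i : Fin n => if id i = j then (1 : ℝ) else 0) = 1 := by
    ext i j; simp [Matrix.one_apply, eq_comm]
  rw [this]; simp

/-- Stated for a space without a norm, so that the norm coming from the core does not compete with
the sup norm of `Cn n`. -/
theorem exists_orthonormal_basis_of_core {V : Type*} [AddCommGroup V] [Module ℂ V]
    [FiniteDimensional ℂ V] {n : ℕ} (hn : Module.finrank ℂ V = n)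
    (c : InnerProductSpace.Core ℂ V) :
    ∃ b : Module.Basis (Fin n) ℂ V, ∀ u w : Fin n → ℂ,
      c.inner (∑ k, u k • b k) (∑ k, w k • b k) = ∑ k, (starRingEnd ℂ) (u k) * w k := by
  let := c.toNormedAddCommGroup
  let := InnerProductSpace.ofCore c.toCore
  subst hn
  refine ⟨(stdOrthonormalBasis ℂ V).toBasis, fun u w => ?_⟩
  have h := orthonormal_iff_ite.1 (stdOrthonormalBasis ℂ V).orthonormal
  change inner ℂ _ _ = _
  rw [sum_inner]
  refine Finset.sum_congr rfl fun k _ => ?_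
  rw [inner_sum]
  simp [inner_smul_left, inner_smul_right, h, mul_comm]

theorem form_swap {V : Type*} [NormedAddCommGroup V] [NormedSpace ℝ V]
    (η : V [⋀^Fin 2]→L[ℝ] ℝ) (u v : V) : η ![u, v] = -η ![v, u] := by
  have h := map_comp_perm η ![v, u] (Equiv.swap 0 1)
  rw [Equiv.Perm.sign_swap (by simp)] at h
  have h2 : ![v, u] ∘ Equiv.swap (0 : Fin 2) 1 = ![u, v] := by
    funext i; fin_cases i <;> simp
  simpa [h2] using h

theorem form_add_left {V : Type*} [NormedAddCommGroup V] [NormedSpace ℝ V]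
    (η : V [⋀^Fin 2]→L[ℝ] ℝ) (u u' v : V) : η ![u + u', v] = η ![u, v] + η ![u', v] :=
  η.vecCons_add ![v] u u'

theorem form_smul_left {V : Type*} [NormedAddCommGroup V] [NormedSpace ℝ V]
    (η : V [⋀^Fin 2]→L[ℝ] ℝ) (c : ℝ) (u v : V) : η ![c • u, v] = c * η ![u, v] :=
  η.vecCons_smul ![v] c u

/-- The hermitian inner product of a positive `(1,1)`-form. -/
@[reducible]
def hermitianCore {n : ℕ} (η : Cn n [⋀^Fin 2]→L[ℝ] ℝ)
    (hJ : ∀ u v, η ![cplxJ n u, cplxJ n v] = η ![u, v])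
    (hpos : ∀ u, u ≠ 0 → 0 < η ![u, cplxJ n u]) : InnerProductSpace.Core ℂ (Cn n) where
  inner u v := ⟨η ![u, cplxJ n v], η ![u, v]⟩
  conj_inner_symm u v := by
    have h1 : η ![v, cplxJ n u] = η ![u, cplxJ n v] := by
      rw [← hJ v, form_swap]
      have : cplxJ n (cplxJ n u) = (-1 : ℝ) • u := by
        funext j; simp [cplxJ_apply, ← mul_assoc]
      rw [this, form_smul_left]; ring
    apply Complex.ext
    · simpa using h1
    · simpa using (form_swap η u v).symm
  re_inner_nonneg u := by
    rcases eq_or_ne u 0 with rfl | hu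
    · have := form_smul_left η 0 0 (cplxJ n (0 : Cn n))
      simp only [zero_smul, zero_mul] at this
      exact this.ge
    · exact (hpos u hu).le
  add_left u v w := by
    apply Complex.ext
    · exact form_add_left η u v _
    · exact form_add_left η u v _
  smul_left u v r := by
    have h0 : r • u = r.re • u + r.im • cplxJ n u := by
      funext j
      simp only [cplxJ_apply, Pi.smul_apply, Pi.add_apply, smul_eq_mul, Complex.real_smul]
      nth_rewrite 1 [← Complex.re_add_im r]
      ring
    have h1 : η ![cplxJ n u, v] = -η ![u, cplxJ n v] := by
      rw [← hJ (cplxJ n u)]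
      have : cplxJ n (cplxJ n u) = (-1 : ℝ) • u := by
        funext j; simp [cplxJ_apply, ← mul_assoc]
      rw [this, form_smul_left]; ring
    apply Complex.ext
    · simp only [h0, form_add_left, form_smul_left, hJ]
      simp
    · simp only [h0, form_add_left, form_smul_left, h1]
      simp
  definite u h := by
    by_contra hu
    exact (hpos u hu).ne' (congrArg Complex.re h)

/-- In a basis unitary for `hermitianCore` the form is the model one. The change of basis is complex
linear, hence multiplies the top coefficient by `|det|² ≥ 0`. -/
theorem topCoeff_wedgePow_pos {n : ℕ} (η : Cn n [⋀^Fin 2]→L[ℝ] ℝ)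
    (hJ : ∀ u v, η ![cplxJ n u, cplxJ n v] = η ![u, v])
    (hpos : ∀ u, u ≠ 0 → 0 < η ![u, cplxJ n u]) : 0 < topCoeff (wedgePow η n) := by
  let c := hermitianCore η hJ hpos
  obtain ⟨b, hb⟩ := exists_orthonormal_basis_of_core (n := n) (by simp) c
  let e : Cn n ≃ₗ[ℂ] Cn n := b.equivFun.symm
  let L : Cn n →L[ℝ] Cn n := LinearMap.toContinuousLinearMap (e.toLinearMap.restrictScalars ℝ)
  have hL : ∀ u w, c.inner (L u) (L w) = ∑ k, (starRingEnd ℂ) (u k) * w k := by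
    intro u w
    have hu : ∀ u, L u = ∑ k, u k • b k := fun u => b.equivFun_symm_apply u
    rw [hu, hu, hb]
  have h1 : 0 < topCoeff (wedgePow (η.compContinuousLinearMap L) n) := by
    apply wedgePow_stdFrame_pos
    intro w
    have h2 : (c.inner (L (w 0)) (L (w 1))).im = η.compContinuousLinearMap L w := by
      change η ![L (w 0), L (w 1)] = η (L ∘ w)
      congr 1
      funext i; fin_cases i <;> rfl
    rw [← h2, hL, Complex.im_sum]
    refine Finset.sum_congr rfl fun k _ => ?_
    simp
    ring
  rw [wedgePow_compContinuousLinearMap, topCoeff_compContinuousLinearMap rfl] at h1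
  have h3 : LinearMap.det (L : Cn n →ₗ[ℝ] Cn n) = Complex.normSq (LinearMap.det e.toLinearMap) :=
    det_restrictScalars_eq_normSq _
  rw [h3] at h1
  exact pos_of_mul_pos_right h1 (Complex.normSq_nonneg _)

end Positivity

/-! ### Exterior calculus on open subsets of `ℂⁿ` -/

section FlatCalculus

variable {V : Type*} [NormedAddCommGroup V] [NormedSpace ℝ V]

theorem contDiff_of_contDiffAt_tsupport {F : Type*} [NormedAddCommGroup F] [NormedSpace ℝ F]
    {f : V → F} (hf : ∀ y ∈ tsupport f, ContDiffAt ℝ ∞ f y) : ContDiff ℝ ∞ f := by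
  refine contDiff_iff_contDiffAt.2 fun y => ?_
  by_cases hy : y ∈ tsupport f
  · exact hf y hy
  · exact contDiffAt_const.congr_of_eventuallyEq (notMem_tsupport_iff_eventuallyEq.1 hy)

theorem contDiffAt_extDeriv {k : ℕ} {α : V → V [⋀^Fin k]→L[ℝ] ℝ} {y : V}
    (hα : ContDiffAt ℝ ∞ α y) : ContDiffAt ℝ ∞ (extDeriv α) y :=
  (ContinuousAlternatingMap.alternatizeUncurryFinCLM ℝ V ℝ).contDiff.contDiffAt.comp y
    (hα.fderiv_right (by simp))

theorem contDiffAt_wedge {k l : ℕ} {α : V → V [⋀^Fin k]→L[ℝ] ℝ} {β : V → V [⋀^Fin l]→L[ℝ] ℝ}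
    {y : V} (hα : ContDiffAt ℝ ∞ α y) (hβ : ContDiffAt ℝ ∞ β y) :
    ContDiffAt ℝ ∞ (fun z => wedge (α z) (β z)) y := by
  have h : ContDiff ℝ ∞ (wedgeL V k l) :=
    ContinuousLinearMap.contDiff (𝕜 := ℝ) (E := V [⋀^Fin k]→L[ℝ] ℝ)
      (F := (V [⋀^Fin l]→L[ℝ] ℝ) →L[ℝ] V [⋀^Fin (k + l)]→L[ℝ] ℝ) (wedgeL V k l)
  exact (h.contDiffAt.comp y hα).clm_apply hβ

theorem contDiffAt_wedgePow {η : V → V [⋀^Fin 2]→L[ℝ] ℝ} {y : V} (hη : ContDiffAt ℝ ∞ η y)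
    (m : ℕ) : ContDiffAt ℝ ∞ (fun z => wedgePow (η z) m) y := by
  induction m with
  | zero => exact contDiffAt_const
  | succ m ih => exact contDiffAt_wedge ih hη

theorem contDiffAt_constOfIsEmpty {f : V → ℝ} {y : V} (hf : ContDiffAt ℝ ∞ f y) :
    ContDiffAt ℝ ∞ (fun z => ContinuousAlternatingMap.constOfIsEmpty ℝ V (Fin 0) (f z)) y :=
  (ContinuousAlternatingMap.constOfIsEmptyLIE ℝ V ℝ (Fin 0)).contDiff.contDiffAt.comp y hf

theorem contDiffAt_compContinuousLinearMap_const {W : Type*} [NormedAddCommGroup W]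
    [NormedSpace ℝ W] {k : ℕ} {α : V → V [⋀^Fin k]→L[ℝ] ℝ}
    {y : V} (hα : ContDiffAt ℝ ∞ α y) (L : W →L[ℝ] V) :
    ContDiffAt ℝ ∞ (fun z => (α z).compContinuousLinearMap L) y := by
  have h := (ContinuousAlternatingMap.compContinuousLinearMapCLM (𝕜 := ℝ) (ι := Fin k) (F := ℝ)
    L).contDiff (n := ∞)
  exact h.contDiffAt.comp y hα

theorem extDeriv_wedge_apply {k : ℕ} {θ : V → V [⋀^Fin 1]→L[ℝ] ℝ}
    {β : V → V [⋀^Fin k]→L[ℝ] ℝ} {y : V} (hθ : DifferentiableAt ℝ θ y)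
    (hβ : DifferentiableAt ℝ β y) (v : Fin (1 + k + 1) → V) :
    extDeriv (fun z => wedge (θ z) (β z)) y v =
      wedge (extDeriv θ y) (β y) (fun i => v (Fin.cast (by omega) i)) -
        wedge (θ y) (extDeriv β y) (fun i => v (Fin.cast (by omega) i)) := by
  have h := ((wedgeL V 1 k).hasFDerivAt_of_bilinear hθ.hasFDerivAt hβ.hasFDerivAt).fderiv
  have h1 := alternatizeUncurryFin_wedge_left (fderiv ℝ θ y) (β y)
    (fun i => v (Fin.cast (by omega) i))
  have h2 := alternatizeUncurryFin_wedge_right (θ y) (fderiv ℝ β y)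
    (fun i => v (Fin.cast (by omega) i))
  rw [extDeriv, extDeriv, extDeriv, ← h1, sub_eq_add_neg]
  refine Eq.trans ?_ (congrArg _ h2)
  change ContinuousAlternatingMap.alternatizeUncurryFin
    (fderiv ℝ (fun z => wedgeL V 1 k (θ z) (β z)) y) v = _
  rw [h, ContinuousAlternatingMap.alternatizeUncurryFin_add, ContinuousAlternatingMap.add_apply]
  exact add_comm _ _

theorem extDeriv_smul_apply {k : ℕ} {f : V → ℝ} {β : V → V [⋀^Fin k]→L[ℝ] ℝ} {y : V}
    (hf : DifferentiableAt ℝ f y) (hβ : DifferentiableAt ℝ β y) (v : Fin (k + 1) → V) :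
    extDeriv (fun z => f z • β z) y v =
      wedge (extDeriv (fun z => ContinuousAlternatingMap.constOfIsEmpty ℝ V (Fin 0) (f z)) y)
        (β y) (fun i => v (Fin.cast (by omega) i)) + f y * extDeriv β y v := by
  have h := alternatizeUncurryFin_smulRight (fderiv ℝ f y)
    (extDeriv (fun z => ContinuousAlternatingMap.constOfIsEmpty ℝ V (Fin 0) (f z)) y)
    (fun w => by rw [extDeriv_constOfIsEmpty]; rfl) (β y) (fun i => v (Fin.cast (by omega) i))
  simp only [Fin.cast_cast, Fin.cast_eq_self] at h
  have h' := (hf.hasFDerivAt.smul hβ.hasFDerivAt).fderiv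
  rw [← h]
  change ContinuousAlternatingMap.alternatizeUncurryFin (fderiv ℝ (f • β) y) v = _
  rw [h', ContinuousAlternatingMap.alternatizeUncurryFin_add,
    ContinuousAlternatingMap.alternatizeUncurryFin_smul, ContinuousAlternatingMap.add_apply]
  exact add_comm _ _

/-- Stokes' theorem for compactly supported forms of codimension one. -/
theorem integral_extDeriv_apply_eq_zero [MeasurableSpace V] [BorelSpace V]
    [FiniteDimensional ℝ V] (μ : Measure V) [μ.IsAddHaarMeasure] {k : ℕ}
    {η : V → V [⋀^Fin k]→L[ℝ] ℝ} (hη : ContDiff ℝ ∞ η) (hc : HasCompactSupport η)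
    (v : Fin (k + 1) → V) : ∫ y, extDeriv η y v ∂μ = 0 := by
  have hd : Differentiable ℝ η := hη.differentiable (by simp)
  simp_rw [fun y => extDeriv_apply (hd y) v, zsmul_eq_mul]
  have hs : ∀ w : Fin k → V, ContDiff ℝ ∞ fun y => η y w := fun w =>
    (ContinuousAlternatingMap.apply ℝ _ ℝ w).contDiff.comp hη
  have hcs : ∀ w : Fin k → V, HasCompactSupport fun y => η y w := fun w =>
    hc.comp_left (g := fun a : V [⋀^Fin k]→L[ℝ] ℝ => a w) rfl
  have hi : ∀ (w : Fin k → V) (u : V), Integrable (fun y => fderiv ℝ (fun y => η y w) y u) μ :=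
    fun w u => (((hs w).continuous_fderiv (by simp)).clm_apply
      continuous_const).integrable_of_hasCompactSupport ((hcs w).fderiv_apply ℝ u)
  rw [integral_finsetSum _ fun i _ => (hi (i.removeNth v) (v i)).const_mul
    (((-1 : ℤ) ^ (i : ℕ) : ℤ) : ℝ)]
  refine Finset.sum_eq_zero fun i _ => ?_
  rw [integral_const_mul]
  have h0 : ∫ y, fderiv ℝ (fun y => η y (i.removeNth v)) y (v i) ∂μ = 0 := by
    -- Integration by parts against the constant function `1`.
    have := integral_mul_fderiv_eq_neg_fderiv_mul_of_integrable (μ := μ) (𝕜 := ℝ)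
      (f := fun _ => (1 : ℝ)) (g := fun y => η y (i.removeNth v)) (v := v i) (by simp)
      (by simpa using hi (i.removeNth v) (v i))
      (by simpa using (hs _).continuous.integrable_of_hasCompactSupport (hcs _))
      (by simp) (fun y _ => ((hs _).differentiable (by simp)) y)
    simpa using this
  rw [h0, mul_zero]

theorem extDeriv_zero_form {k : ℕ} (y : V) :
    extDeriv (0 : V → V [⋀^Fin k]→L[ℝ] ℝ) y = 0 := by
  rw [extDeriv, fderiv_zero]
  exact map_zero (ContinuousAlternatingMap.alternatizeUncurryFinCLM ℝ V ℝ)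

end FlatCalculus

/-! ### The operator `d^c` on open subsets of `ℂⁿ` and the local integration by parts. -/

section FlatDc

variable {n : ℕ}

/-- The operator `d^c` on forms on open subsets of `ℂⁿ`. -/
def flatDc {k : ℕ} (α : Cn n → Cn n [⋀^Fin k]→L[ℝ] ℝ) (y : Cn n) : Cn n [⋀^Fin (k + 1)]→L[ℝ] ℝ :=
  (1 / 2 : ℝ) • (extDeriv (fun z => (α z).compContinuousLinearMap ((1 : ℝ) • cplxJ n)) y
    ).compContinuousLinearMap ((-1 : ℝ) • cplxJ n)

theorem contDiffAt_flatDc {k : ℕ} {α : Cn n → Cn n [⋀^Fin k]→L[ℝ] ℝ} {y : Cn n}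
    (hα : ContDiffAt ℝ ∞ α y) : ContDiffAt ℝ ∞ (flatDc α) y :=
  (contDiffAt_compContinuousLinearMap_const
    (contDiffAt_extDeriv (contDiffAt_compContinuousLinearMap_const hα _)) _).const_smul _

/-- A function, as a `0`-form. -/
def flatFun (f : Cn n → ℝ) (y : Cn n) : Cn n [⋀^Fin 0]→L[ℝ] ℝ :=
  ContinuousAlternatingMap.constOfIsEmpty ℝ (Cn n) (Fin 0) (f y)

theorem flatDc_flatFun (f : Cn n → ℝ) (y : Cn n) :
    flatDc (flatFun f) y =
      (1 / 2 : ℝ) • (extDeriv (flatFun f) y).compContinuousLinearMap ((-1 : ℝ) • cplxJ n) := rfl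

theorem stdFrame_cast {k l : ℕ} (h : k = l) :
    (fun i => stdFrame n l (Fin.cast h i)) = stdFrame n k := rfl

theorem cplxJ_comp_neg (n : ℕ) :
    ((-1 : ℝ) • cplxJ n).comp (cplxJ n) = ContinuousLinearMap.id ℝ (Cn n) := by
  ext u j
  simp [cplxJ_apply, ← mul_assoc]

/-- The identity `d^c f ∧ dβ = - df ∧ d^c β` in top degree. -/
theorem topCoeff_flatDc_wedge {k : ℕ} (hk : k + 2 = 2 * n) {f : Cn n → ℝ}
    {β : Cn n → Cn n [⋀^Fin k]→L[ℝ] ℝ} {y : Cn n}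
    (hJ : ∀ᶠ z in nhds y, (β z).compContinuousLinearMap ((1 : ℝ) • cplxJ n) = β z) :
    topCoeff (wedge (flatDc (flatFun f) y) (extDeriv β y)) =
      -topCoeff (wedge (extDeriv (flatFun f) y) (flatDc β y)) := by
  have h1 : flatDc β y = (1 / 2 : ℝ) •
      (extDeriv β y).compContinuousLinearMap ((-1 : ℝ) • cplxJ n) := by
    rw [flatDc, Filter.EventuallyEq.extDeriv_eq (ω₂ := β) hJ]
  -- As `det J = 1`, pulling back by `J` does not change a top form. This pullback sends `df` to `-2
  -- d^c f` and, `β` being `J`-invariant, `d^c β` to `½ dβ`.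
  have h2 := topCoeff_compContinuousLinearMap (show 0 + 1 + (k + 1) = 2 * n by omega)
    (wedge (extDeriv (flatFun f) y) (flatDc β y)) (cplxJ n)
  rw [det_cplxJ, one_mul, ← wedge_compContinuousLinearMap] at h2
  have h3 : (flatDc β y).compContinuousLinearMap (cplxJ n) = (1 / 2 : ℝ) • extDeriv β y := by
    rw [h1]
    ext w
    change (1 / 2 : ℝ) * extDeriv β y (fun i => (((-1 : ℝ) • cplxJ n).comp (cplxJ n)) (w i)) = _
    rw [cplxJ_comp_neg]
    rfl
  have h4 : flatDc (flatFun f) y =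
      (-1 / 2 : ℝ) • (extDeriv (flatFun f) y).compContinuousLinearMap (cplxJ n) := by
    rw [flatDc_flatFun]
    ext w
    have : (extDeriv (flatFun f) y) (fun i => (-1 : ℝ) • cplxJ n (w i)) =
        (-1 : ℝ) * (extDeriv (flatFun f) y) (fun i => cplxJ n (w i)) := by
      have := (extDeriv (flatFun f) y).map_smul_univ (fun _ => (-1 : ℝ)) (fun i => cplxJ n (w i))
      simpa using this
    change (1 / 2 : ℝ) * (extDeriv (flatFun f) y) (fun i => (-1 : ℝ) • cplxJ n (w i)) =
      (-1 / 2 : ℝ) * (extDeriv (flatFun f) y) (fun i => cplxJ n (w i))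
    rw [this]; ring
  rw [← h2, h3, h4, wedge_smul_left, wedge_smul_right]
  simp only [topCoeff, ContinuousAlternatingMap.smul_apply, smul_eq_mul]
  ring

/-- Two Leibniz rules, `d(d^c f ∧ β) = dd^c f ∧ β - d^c f ∧ dβ` and `d(f d^c β) = df ∧ d^c β + f
dd^c β`; `topCoeff_flatDc_wedge` matches their mixed terms. -/
theorem topCoeff_ddc_wedge {k : ℕ} (hk : k + 2 = 2 * n) {f : Cn n → ℝ}
    {β : Cn n → Cn n [⋀^Fin k]→L[ℝ] ℝ} {y : Cn n} (hf : ContDiffAt ℝ ∞ f y)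
    (hβ : ContDiffAt ℝ ∞ β y)
    (hJ : ∀ᶠ z in nhds y, (β z).compContinuousLinearMap ((1 : ℝ) • cplxJ n) = β z) :
    topCoeff (wedge (extDeriv (flatDc (flatFun f)) y) (β y)) =
      topCoeff (extDeriv (fun z => wedge (flatDc (flatFun f) z) (β z)) y) -
        topCoeff (extDeriv (fun z => f z • flatDc β z) y) +
        f y * topCoeff (extDeriv (flatDc β) y) := by
  have hf0 : ContDiffAt ℝ ∞ (flatFun f) y := contDiffAt_constOfIsEmpty hf
  have h1 := extDeriv_wedge_apply (θ := flatDc (flatFun f)) (β := β)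
    ((contDiffAt_flatDc hf0).differentiableAt (by simp)) (hβ.differentiableAt (by simp))
    (stdFrame n _)
  have h2 := extDeriv_smul_apply (hf.differentiableAt (by simp))
    ((contDiffAt_flatDc hβ).differentiableAt (by simp)) (stdFrame n _)
  have h3 := topCoeff_flatDc_wedge hk (f := f) hJ
  simp only [stdFrame_cast] at h1 h2
  simp only [topCoeff] at h3 ⊢
  rw [h1, h2]
  change _ = _ - (wedge (extDeriv (flatFun f) y) (flatDc β y) _ + _) + _
  have h4 : wedge (flatDc (flatFun f) y) (extDeriv β y) (stdFrame n _) =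
    -wedge (extDeriv (flatFun f) y) (flatDc β y) (stdFrame n _) := h3
  linear_combination h4

/-- The two exact terms of `topCoeff_ddc_wedge` are supported in `tsupport f`, a compact subset of
`U`, so Stokes' theorem removes them even though `β` is smooth only on `U`. -/
theorem integral_topCoeff_ddc_wedge {k : ℕ} (hk : k + 2 = 2 * n) {f : Cn n → ℝ}
    {β : Cn n → Cn n [⋀^Fin k]→L[ℝ] ℝ} {U : Set (Cn n)} (hU : IsOpen U)
    (hf : ContDiff ℝ ∞ f) (hc : HasCompactSupport f) (hfU : tsupport f ⊆ U)
    (hβ : ContDiffOn ℝ ∞ β U)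
    (hJ : ∀ z ∈ U, (β z).compContinuousLinearMap ((1 : ℝ) • cplxJ n) = β z) :
    ∫ y in U, topCoeff (wedge (extDeriv (flatDc (flatFun f)) y) (β y)) =
      ∫ y in U, f y * topCoeff (extDeriv (flatDc β) y) := by
  have hβ' : ∀ y ∈ U, ContDiffAt ℝ ∞ β y := fun y hy => hβ.contDiffAt (hU.mem_nhds hy)
  have hf0 : ContDiff ℝ ∞ (flatFun f) := contDiff_iff_contDiffAt.2 fun y =>
    contDiffAt_constOfIsEmpty hf.contDiffAt
  have hz : ∀ y, y ∉ tsupport f → flatDc (flatFun f) y = 0 := by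
    intro y hy
    have h0 : flatFun f =ᶠ[nhds y] 0 := by
      filter_upwards [notMem_tsupport_iff_eventuallyEq.1 hy] with z hz
      rw [flatFun, hz]; rfl
    rw [flatDc_flatFun, h0.extDeriv_eq, extDeriv_zero_form]
    ext w
    simp
  have hs1 : Function.support (fun z => wedge (flatDc (flatFun f) z) (β z)) ⊆ tsupport f := by
    intro y hy
    by_contra h
    exact hy (by simp only; rw [hz y h, ← wedgeL_apply, map_zero]; rfl)
  have hs2 : Function.support (fun z => f z • flatDc β z) ⊆ tsupport f :=
    (Function.support_smul_subset_left f (flatDc β)).trans subset_closure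
  have hc1 : HasCompactSupport (fun z => wedge (flatDc (flatFun f) z) (β z)) :=
    hc.mono' hs1
  have hc2 : HasCompactSupport (fun z => f z • flatDc β z) := hc.mono' hs2
  have hd1 : ContDiff ℝ ∞ (fun z => wedge (flatDc (flatFun f) z) (β z)) :=
    contDiff_of_contDiffAt_tsupport fun y hy => contDiffAt_wedge (contDiffAt_flatDc hf0.contDiffAt)
      (hβ' y (hfU (closure_minimal hs1 (isClosed_tsupport f) hy)))
  have hd2 : ContDiff ℝ ∞ (fun z => f z • flatDc β z) :=
    contDiff_of_contDiffAt_tsupport fun y hy => hf.contDiffAt.smul (contDiffAt_flatDc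
      (hβ' y (hfU (closure_minimal hs2 (isClosed_tsupport f) hy))))
  have key : ∀ {l : ℕ} (η : Cn n → Cn n [⋀^Fin l]→L[ℝ] ℝ), ContDiff ℝ ∞ η →
      Function.support η ⊆ tsupport f →
      IntegrableOn (fun y => topCoeff (extDeriv η y)) U ∧
        ∫ y in U, topCoeff (extDeriv η y) = 0 := by
    intro l η hη hs
    have hcη : HasCompactSupport η := hc.mono' hs
    have hzero' : ∀ y, y ∉ tsupport η → topCoeff (extDeriv η y) = 0 := by
      intro y hy
      rw [(notMem_tsupport_iff_eventuallyEq.1 hy).extDeriv_eq, extDeriv_zero_form]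
      rfl
    have hzero : ∀ y, y ∉ U → topCoeff (extDeriv η y) = 0 := fun y hy =>
      hzero' y fun h => hy (hfU (closure_minimal hs (isClosed_tsupport f) h))
    have hcont : Continuous fun y => topCoeff (extDeriv η y) :=
      (ContinuousAlternatingMap.apply ℝ _ ℝ _).continuous.comp
        (contDiff_iff_contDiffAt.2 fun y => contDiffAt_extDeriv hη.contDiffAt).continuous
    have hcs : HasCompactSupport fun y => topCoeff (extDeriv η y) := by
      refine hcη.mono' fun y hy => ?_
      by_contra h
      exact hy (hzero' y h)
    refine ⟨(hcont.integrable_of_hasCompactSupport hcs).integrableOn, ?_⟩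
    rw [setIntegral_eq_integral_of_forall_compl_eq_zero hzero]
    exact integral_extDeriv_apply_eq_zero _ hη hcη _
  have hi3 : IntegrableOn (fun y => f y * topCoeff (extDeriv (flatDc β) y)) U := by
    have hcont : Continuous fun y => f y * topCoeff (extDeriv (flatDc β) y) := by
      refine continuous_of_tsupport fun y hy => hf.continuous.continuousAt.mul ?_
      have hy' : y ∈ U := hfU (closure_mono (Function.support_mul_subset_left _ _) hy)
      exact (ContinuousAlternatingMap.apply ℝ _ ℝ _).continuous.continuousAt.comp
        (contDiffAt_extDeriv (contDiffAt_flatDc (hβ' y hy'))).continuousAt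
    exact (hcont.integrable_of_hasCompactSupport hc.mul_right).integrableOn
  have hEq : ∫ y in U, topCoeff (wedge (extDeriv (flatDc (flatFun f)) y) (β y)) =
      ∫ y in U, (topCoeff (extDeriv (fun z => wedge (flatDc (flatFun f) z) (β z)) y) -
        topCoeff (extDeriv (fun z => f z • flatDc β z) y) +
        f y * topCoeff (extDeriv (flatDc β) y)) :=
    setIntegral_congr_fun hU.measurableSet fun y hy => topCoeff_ddc_wedge hk hf.contDiffAt
      (hβ' y hy) (Filter.eventually_of_mem (hU.mem_nhds hy) hJ)
  obtain ⟨i1, e1⟩ := key _ hd1 hs1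
  obtain ⟨i2, e2⟩ := key _ hd2 hs2
  have i12 : IntegrableOn (fun y =>
      topCoeff (extDeriv (fun z => wedge (flatDc (flatFun f) z) (β z)) y) -
        topCoeff (extDeriv (fun z => f z • flatDc β z) y)) U := i1.sub i2
  rw [hEq, integral_add i12 hi3, integral_sub i1 i2, e1, e2, sub_zero, zero_add]

end FlatDc

/-! ### Forms in charts -/

section Charts

section Topology

variable {n : ℕ} {X : Type*} [TopologicalSpace X] {φ ψ : OpenPartialHomeomorph X (Cn n)}

theorem eventually_mem_target_source {y : Cn n} (hy : y ∈ φ.target)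
    (hyψ : φ.symm y ∈ ψ.source) : ∀ᶠ z in nhds y, z ∈ φ.target ∧ φ.symm z ∈ ψ.source :=
  (φ.open_target.eventually_mem hy).and
    ((φ.continuousAt_symm hy).eventually (ψ.open_source.eventually_mem hyψ))

theorem fderiv_transition_self {y : Cn n} (hy : y ∈ φ.target) :
    fderiv ℝ (fun z => φ (φ.symm z)) y = ContinuousLinearMap.id ℝ (Cn n) := by
  have h1 : (fun z => φ (φ.symm z)) =ᶠ[nhds y] id := by
    filter_upwards [φ.open_target.mem_nhds hy] with z hz
    exact φ.right_inv hz
  rw [h1.fderiv_eq, fderiv_id]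

end Topology

variable {n : ℕ} {X : Type*} [TopologicalSpace X] [ChartedSpace (Cn n) X]

section Transition

variable [IsManifold 𝓘(ℂ, Cn n) ω X] {φ ψ χ : OpenPartialHomeomorph X (Cn n)}

theorem contDiffAt_complex_transition (hφ : φ ∈ atlas (Cn n) X) (hψ : ψ ∈ atlas (Cn n) X)
    {y : Cn n} (hy : y ∈ φ.target) (hyψ : φ.symm y ∈ ψ.source) :
    ContDiffAt ℂ ω (fun z => ψ (φ.symm z)) y := by
  have h := HasGroupoid.compatible (G := contDiffGroupoid ω 𝓘(ℂ, Cn n)) hφ hψ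
  have h1 := contMDiffOn_iff_contDiffOn.1 (contMDiffOn_of_mem_contDiffGroupoid h)
  refine h1.contDiffAt ((φ.symm.trans ψ).open_source.mem_nhds ?_)
  simp [hy, hyψ]

theorem contDiffAt_transition (hφ : φ ∈ atlas (Cn n) X) (hψ : ψ ∈ atlas (Cn n) X)
    {y : Cn n} (hy : y ∈ φ.target) (hyψ : φ.symm y ∈ ψ.source) :
    ContDiffAt ℝ ∞ (fun z => ψ (φ.symm z)) y :=
  ((contDiffAt_complex_transition hφ hψ hy hyψ).restrict_scalars ℝ).of_le le_top

theorem fderiv_transition (hφ : φ ∈ atlas (Cn n) X) (hψ : ψ ∈ atlas (Cn n) X)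
    {y : Cn n} (hy : y ∈ φ.target) (hyψ : φ.symm y ∈ ψ.source) :
    fderiv ℝ (fun z => ψ (φ.symm z)) y =
      (fderiv ℂ (fun z => ψ (φ.symm z)) y).restrictScalars ℝ :=
  DifferentiableAt.fderiv_restrictScalars ℝ
    ((contDiffAt_complex_transition hφ hψ hy hyψ).differentiableAt (by simp))

theorem fderiv_transition_cplxJ (hφ : φ ∈ atlas (Cn n) X) (hψ : ψ ∈ atlas (Cn n) X)
    {y : Cn n} (hy : y ∈ φ.target) (hyψ : φ.symm y ∈ ψ.source) (u : Cn n) :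
    fderiv ℝ (fun z => ψ (φ.symm z)) y (cplxJ n u) =
      cplxJ n (fderiv ℝ (fun z => ψ (φ.symm z)) y u) := by
  rw [fderiv_transition hφ hψ hy hyψ]
  exact (fderiv ℂ (fun z => ψ (φ.symm z)) y).map_smul Complex.I u

theorem fderiv_transition_comp (hφ : φ ∈ atlas (Cn n) X) (hψ : ψ ∈ atlas (Cn n) X)
    (hχ : χ ∈ atlas (Cn n) X) {y : Cn n} (hy : y ∈ φ.target) (hyψ : φ.symm y ∈ ψ.source)
    (hyχ : φ.symm y ∈ χ.source) :
    fderiv ℝ (fun z => χ (φ.symm z)) y =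
      (fderiv ℝ (fun z => χ (ψ.symm z)) (ψ (φ.symm y))).comp
        (fderiv ℝ (fun z => ψ (φ.symm z)) y) := by
  have h1 : (fun z => χ (φ.symm z)) =ᶠ[nhds y]
      (fun z => χ (ψ.symm z)) ∘ fun z => ψ (φ.symm z) := by
    filter_upwards [eventually_mem_target_source hy hyψ] with z hz
    simp [ψ.left_inv hz.2]
  rw [h1.fderiv_eq, fderiv_comp]
  · refine (contDiffAt_transition hψ hχ (ψ.map_source hyψ) ?_).differentiableAt (by simp)
    rwa [ψ.left_inv hyψ]
  · exact (contDiffAt_transition hφ hψ hy hyψ).differentiableAt (by simp)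

end Transition

theorem DForm.inChart_wedge {k l : ℕ} (α : DForm n X k) (β : DForm n X l)
    (φ : OpenPartialHomeomorph X (Cn n)) (y : Cn n) :
    (α.wedge β).inChart φ y = GauduchonFactor.wedge (α.inChart φ y) (β.inChart φ y) :=
  (wedge_compContinuousLinearMap _ _ _).symm

theorem DForm.inChart_pow (α : DForm n X 2) (m : ℕ)
    (φ : OpenPartialHomeomorph X (Cn n)) (y : Cn n) :
    (α.pow m).inChart φ y = wedgePow (α.inChart φ y) m :=
  (wedgePow_compContinuousLinearMap _ _ _).symm

theorem inChart_ofFun (f : X → ℝ) (φ : OpenPartialHomeomorph X (Cn n)) :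
    (ofFun n f).inChart φ = flatFun (f ∘ φ.symm) := by
  funext y
  ext w
  rfl

theorem DForm.IsSmooth.contDiffAt {k : ℕ} {α : DForm n X k} (hα : α.IsSmooth)
    {φ : OpenPartialHomeomorph X (Cn n)}
    (hφ : φ ∈ atlas (Cn n) X) {y : Cn n} (hy : y ∈ φ.target) :
    ContDiffAt ℝ ∞ (α.inChart φ) y :=
  (hα φ hφ).contDiffAt (φ.open_target.mem_nhds hy)

theorem DForm.IsSmooth.wedge {k l : ℕ} {α : DForm n X k} {β : DForm n X l} (hα : α.IsSmooth)
    (hβ : β.IsSmooth) : (α.wedge β).IsSmooth := by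
  intro φ hφ y hy
  have : (α.wedge β).inChart φ =
      fun z => GauduchonFactor.wedge (α.inChart φ z) (β.inChart φ z) :=
    funext fun z => DForm.inChart_wedge α β φ z
  rw [this]
  exact (contDiffAt_wedge (hα.contDiffAt hφ hy) (hβ.contDiffAt hφ hy)).contDiffWithinAt

theorem DForm.IsSmooth.pow {α : DForm n X 2} (hα : α.IsSmooth) (m : ℕ) : (α.pow m).IsSmooth := by
  intro φ hφ y hy
  have : (α.pow m).inChart φ = fun z => wedgePow (α.inChart φ z) m :=
    funext fun z => DForm.inChart_pow α m φ z
  rw [this]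
  exact (contDiffAt_wedgePow (hα.contDiffAt hφ hy) m).contDiffWithinAt

variable [IsManifold 𝓘(ℂ, Cn n) ω X] {φ ψ : OpenPartialHomeomorph X (Cn n)}

theorem DForm.inChart_eq_pullback {k : ℕ} (α : DForm n X k) (hφ : φ ∈ atlas (Cn n) X)
    (hψ : ψ ∈ atlas (Cn n) X) {y : Cn n} (hy : y ∈ φ.target) (hyψ : φ.symm y ∈ ψ.source) :
    α.inChart φ y = (α.inChart ψ (ψ (φ.symm y))).compContinuousLinearMap
      (fderiv ℝ (fun z => ψ (φ.symm z)) y) := by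
  rw [DForm.inChart, DForm.inChart, ψ.left_inv hyψ,
    fderiv_transition_comp hφ hψ (chart_mem_atlas (Cn n) (φ.symm y)) hy hyψ (mem_chart_source _ _)]
  rfl

theorem DForm.inChart_compJ {k : ℕ} (α : DForm n X k) (c : ℝ) (hφ : φ ∈ atlas (Cn n) X)
    {y : Cn n} (hy : y ∈ φ.target) :
    (α.compJ c).inChart φ y = (α.inChart φ y).compContinuousLinearMap (c • cplxJ n) := by
  ext w
  have h := fderiv_transition_cplxJ hφ (chart_mem_atlas (Cn n) (φ.symm y)) hy
    (mem_chart_source _ _)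
  change α (φ.symm y) (fun i => (c • cplxJ n) (fderiv ℝ _ y (w i))) =
    α (φ.symm y) (fun i => fderiv ℝ _ y ((c • cplxJ n) (w i)))
  congr 1
  funext i
  simp [h]

/-- By definition `d` uses a different preferred chart at each point; naturality of the exterior
derivative under the transition maps makes it computable in one fixed chart. -/
theorem DForm.inChart_d {k : ℕ} {α : DForm n X k} (hα : α.IsSmooth) (hφ : φ ∈ atlas (Cn n) X)
    {y : Cn n} (hy : y ∈ φ.target) : α.d.inChart φ y = extDeriv (α.inChart φ) y := by
  set x := φ.symm y with hx
  set ψ := chartAt (Cn n) x with hψdef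
  have hψ : ψ ∈ atlas (Cn n) X := chart_mem_atlas _ _
  have hyψ : φ.symm y ∈ ψ.source := mem_chart_source _ _
  have h1 : α.inChart φ =ᶠ[nhds y] fun z => (α.inChart ψ (ψ (φ.symm z))).compContinuousLinearMap
      (fderiv ℝ (fun z => ψ (φ.symm z)) z) := by
    filter_upwards [eventually_mem_target_source hy hyψ] with z hz
    exact α.inChart_eq_pullback hφ hψ hz.1 hz.2
  rw [h1.extDeriv_eq, extDeriv_pullback (r := ∞)]
  · rfl
  · exact (hα.contDiffAt hψ (ψ.map_source hyψ)).differentiableAt (by simp)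
  · exact contDiffAt_transition hφ hψ hy hyψ
  · rw [minSmoothness_of_isRCLikeNormedField]
    exact WithTop.coe_le_coe.2 le_top

theorem DForm.IsSmooth.d {k : ℕ} {α : DForm n X k} (hα : α.IsSmooth) : α.d.IsSmooth :=
  fun _ hφ _ hy => ((contDiffAt_extDeriv (hα.contDiffAt hφ hy)).congr_of_eventuallyEq
    (Filter.eventually_of_mem (OpenPartialHomeomorph.open_target _ |>.mem_nhds hy)
      fun _ hz => DForm.inChart_d hα hφ hz)).contDiffWithinAt

theorem DForm.IsSmooth.compJ {k : ℕ} {α : DForm n X k} (hα : α.IsSmooth) (c : ℝ) :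
    (α.compJ c).IsSmooth :=
  fun _ hφ _ hy => ((contDiffAt_compContinuousLinearMap_const (hα.contDiffAt hφ hy)
    (c • cplxJ n)).congr_of_eventuallyEq
    (Filter.eventually_of_mem (OpenPartialHomeomorph.open_target _ |>.mem_nhds hy)
      fun _ hz => α.inChart_compJ c hφ hz)).contDiffWithinAt

theorem DForm.inChart_dc {k : ℕ} {α : DForm n X k} (hα : α.IsSmooth) (hφ : φ ∈ atlas (Cn n) X)
    {y : Cn n} (hy : y ∈ φ.target) : α.dc.inChart φ y = flatDc (α.inChart φ) y := by
  have h1 : α.dc.inChart φ y = (1 / 2 : ℝ) • ((α.compJ 1).d.compJ (-1)).inChart φ y := rfl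
  have h2 : (α.compJ 1).inChart φ =ᶠ[nhds y]
      fun z => (α.inChart φ z).compContinuousLinearMap ((1 : ℝ) • cplxJ n) :=
    Filter.eventually_of_mem (φ.open_target.mem_nhds hy) fun z hz => α.inChart_compJ 1 hφ hz
  rw [h1, DForm.inChart_compJ _ _ hφ hy, DForm.inChart_d (hα.compJ 1) hφ hy, h2.extDeriv_eq]
  rfl

theorem DForm.IsSmooth.dc {k : ℕ} {α : DForm n X k} (hα : α.IsSmooth) : α.dc.IsSmooth :=
  fun _ hφ _ hy => ((contDiffAt_flatDc (hα.contDiffAt hφ hy)).congr_of_eventuallyEq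
    (Filter.eventually_of_mem (OpenPartialHomeomorph.open_target _ |>.mem_nhds hy)
      fun _ hz => DForm.inChart_dc hα hφ hz)).contDiffWithinAt

theorem DForm.inChart_ddc {k : ℕ} {α : DForm n X k} (hα : α.IsSmooth) (hφ : φ ∈ atlas (Cn n) X)
    {y : Cn n} (hy : y ∈ φ.target) :
    α.ddc.inChart φ y = extDeriv (flatDc (α.inChart φ)) y := by
  have h2 : α.dc.inChart φ =ᶠ[nhds y] flatDc (α.inChart φ) :=
    Filter.eventually_of_mem (φ.open_target.mem_nhds hy) fun z hz => DForm.inChart_dc hα hφ hz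
  rw [DForm.ddc, DForm.inChart_d hα.dc hφ hy, h2.extDeriv_eq]

theorem DForm.IsSmooth.ddc {k : ℕ} {α : DForm n X k} (hα : α.IsSmooth) : α.ddc.IsSmooth :=
  hα.dc.d

variable (n X) in
/-- The real manifold underlying a complex manifold. -/
theorem isManifold_real : IsManifold 𝓘(ℝ, Cn n) ∞ X := by
  refine isManifold_of_contDiffOn _ _ _ fun e e' he he' => ?_
  intro y hy
  have hy' : y ∈ e.target ∧ e.symm y ∈ e'.source := by simpa using hy
  exact (contDiffAt_transition he he' hy'.1 hy'.2).contDiffWithinAt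

theorem contDiffOn_comp_symm {f : X → ℝ} (hf : IsSmoothFun n f) (hφ : φ ∈ atlas (Cn n) X) :
    ContDiffOn ℝ ∞ (f ∘ φ.symm) φ.target := by
  have := isManifold_real n X
  have h : ContMDiffOn 𝓘(ℝ, Cn n) 𝓘(ℝ, Cn n) ∞ φ.symm φ.target :=
    contMDiffOn_symm_of_mem_maximalAtlas (IsManifold.subset_maximalAtlas hφ)
  exact contMDiffOn_iff_contDiffOn.1 (ContMDiff.comp_contMDiffOn hf h)

theorem isSmooth_ofFun {f : X → ℝ} (hf : IsSmoothFun n f) : (ofFun n f).IsSmooth := by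
  intro φ hφ y hy
  rw [inChart_ofFun]
  exact (contDiffAt_constOfIsEmpty ((contDiffOn_comp_symm hf hφ).contDiffAt
    (φ.open_target.mem_nhds hy))).contDiffWithinAt

/-! ### Hermitian metrics in charts -/

namespace HermitianMetric

variable (g : HermitianMetric n X)

/-- The transition is holomorphic, so its real Jacobian is the square modulus of the complex one; it
is nonzero because the transition is invertible. -/
theorem det_transition_pos (hφ : φ ∈ atlas (Cn n) X) (hψ : ψ ∈ atlas (Cn n) X)
    {y : Cn n} (hy : y ∈ φ.target) (hyψ : φ.symm y ∈ ψ.source) :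
    0 < (fderiv ℝ (fun z => ψ (φ.symm z)) y).det := by
  have hinv : (fderiv ℝ (fun z => φ (ψ.symm z)) (ψ (φ.symm y))).comp
      (fderiv ℝ (fun z => ψ (φ.symm z)) y) = ContinuousLinearMap.id ℝ (Cn n) := by
    rw [← fderiv_transition_comp hφ hψ hφ hy hyψ (φ.map_target hy), fderiv_transition_self hy]
  have h1 : (fderiv ℝ (fun z => φ (ψ.symm z)) (ψ (φ.symm y))).det *
      (fderiv ℝ (fun z => ψ (φ.symm z)) y).det = 1 := by
    have := congrArg (fun L : Cn n →L[ℝ] Cn n => LinearMap.det (L : Cn n →ₗ[ℝ] Cn n)) hinv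
    simpa [ContinuousLinearMap.det] using this
  have h2 : 0 ≤ (fderiv ℝ (fun z => ψ (φ.symm z)) y).det := by
    rw [fderiv_transition hφ hψ hy hyψ]
    exact (det_restrictScalars_eq_normSq _).ge.trans' (Complex.normSq_nonneg _)
  exact h2.lt_of_ne fun h => by simp [← h] at h1

theorem inChart_invariant (hφ : φ ∈ atlas (Cn n) X) {y : Cn n} (hy : y ∈ φ.target)
    (u v : Cn n) :
    g.form.inChart φ y ![cplxJ n u, cplxJ n v] = g.form.inChart φ y ![u, v] := by
  have h := fderiv_transition_cplxJ hφ (chart_mem_atlas (Cn n) (φ.symm y)) hy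
    (mem_chart_source _ _)
  have h2 : ∀ u v, g.form.inChart φ y ![u, v] = g.form (φ.symm y)
      ![fderiv ℝ (fun z => chartAt (Cn n) (φ.symm y) (φ.symm z)) y u,
        fderiv ℝ (fun z => chartAt (Cn n) (φ.symm y) (φ.symm z)) y v] := by
    intro u v
    rw [DForm.inChart, ContinuousAlternatingMap.compContinuousLinearMap_apply]
    congr 1
    funext i
    fin_cases i <;> rfl
  rw [h2, h2, h, h, g.invariant]

theorem inChart_pos (hφ : φ ∈ atlas (Cn n) X) {y : Cn n} (hy : y ∈ φ.target)
    (u : Cn n) (hu : u ≠ 0) : 0 < g.form.inChart φ y ![u, cplxJ n u] := by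
  have h := fderiv_transition_cplxJ hφ (chart_mem_atlas (Cn n) (φ.symm y)) hy
    (mem_chart_source _ _)
  have hdet := det_transition_pos hφ (chart_mem_atlas (Cn n) (φ.symm y)) hy
    (mem_chart_source _ _)
  set L := fderiv ℝ (fun z => chartAt (Cn n) (φ.symm y) (φ.symm z)) y with hL
  have h2 : g.form.inChart φ y ![u, cplxJ n u] = g.form (φ.symm y) ![L u, cplxJ n (L u)] := by
    rw [DForm.inChart, ContinuousAlternatingMap.compContinuousLinearMap_apply, ← h]
    congr 1
    funext i
    fin_cases i <;> rfl
  rw [h2]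
  refine g.pos _ _ fun h0 => hu ?_
  have hinj : Function.Injective (L : Cn n →ₗ[ℝ] Cn n) := by
    rw [← LinearMap.ker_eq_bot]
    by_contra hker
    exact hdet.ne' (LinearMap.det_eq_zero_iff_ker_ne_bot.2 hker)
  exact hinj (by simpa using h0)

theorem topCoeff_inChart_pos (hφ : φ ∈ atlas (Cn n) X) {y : Cn n} (hy : y ∈ φ.target) :
    0 < topCoeff ((g.form.pow n).inChart φ y) := by
  rw [DForm.inChart_pow]
  exact topCoeff_wedgePow_pos _ (g.inChart_invariant hφ hy) (g.inChart_pos hφ hy)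

theorem inChart_pow_invariant (hφ : φ ∈ atlas (Cn n) X) {y : Cn n} (hy : y ∈ φ.target) (m : ℕ) :
    ((g.form.pow m).inChart φ y).compContinuousLinearMap ((1 : ℝ) • cplxJ n) =
      (g.form.pow m).inChart φ y := by
  rw [DForm.inChart_pow, ← wedgePow_compContinuousLinearMap]
  congr 1
  ext w
  have hw : ∀ w : Fin 2 → Cn n, w = ![w 0, w 1] := fun w => by
    funext i; fin_cases i <;> rfl
  rw [one_smul, hw w, ← g.inChart_invariant hφ hy]
  change g.form.inChart φ y (cplxJ n ∘ ![w 0, w 1]) = _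
  congr 1
  funext i
  fin_cases i <;> rfl

end HermitianMetric

/-- Both coefficients pick up the same Jacobian, so a quotient of top forms may be computed in any
chart. -/
theorem DForm.coeffAt_div_eq {k l : ℕ} (hk : k = 2 * n) (hl : l = 2 * n) (α : DForm n X k)
    (β : DForm n X l) (hφ : φ ∈ atlas (Cn n) X) {y : Cn n} (hy : y ∈ φ.target) :
    α.coeffAt (φ.symm y) / β.coeffAt (φ.symm y) =
      topCoeff (α.inChart φ y) / topCoeff (β.inChart φ y) := by
  have h := HermitianMetric.det_transition_pos hφ (chart_mem_atlas (Cn n) (φ.symm y)) hy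
    (mem_chart_source _ _)
  rw [DForm.inChart, DForm.inChart, topCoeff_compContinuousLinearMap hk,
    topCoeff_compContinuousLinearMap hl]
  exact (mul_div_mul_left _ _ h.ne').symm

end Charts

namespace HermitianMetric

/-! ### The volume measure -/

section ChartMeasurability

variable {n : ℕ} {X : Type*} [TopologicalSpace X] [MeasurableSpace X] [BorelSpace X]

theorem measurableSet_target_inter_preimage (φ : OpenPartialHomeomorph X (Cn n)) {A : Set X}
    (hA : MeasurableSet A) : MeasurableSet (φ.target ∩ φ.symm ⁻¹' A) := by
  have h : Measurable (φ.target.domRestrict φ.symm) :=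
    (continuousOn_iff_continuous_domRestrict.1 φ.continuousOn_symm).measurable
  have := φ.open_target.measurableSet.subtype_image (h hA)
  rwa [Set.domRestrict_eq, Set.preimage_comp, Subtype.image_preimage_coe] at this

theorem aemeasurable_symm (φ : OpenPartialHomeomorph X (Cn n)) (μ : Measure (Cn n))
    (f : Cn n → ENNReal) : AEMeasurable φ.symm ((μ.restrict φ.target).withDensity f) :=
  (φ.continuousOn_symm.aemeasurable φ.open_target.measurableSet).mono_ac
    (withDensity_absolutelyContinuous _ _)

end ChartMeasurability

section Volume

variable {n : ℕ} {X : Type*} [TopologicalSpace X] [ChartedSpace (Cn n) X]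
  (g : HermitianMetric n X) {φ ψ : OpenPartialHomeomorph X (Cn n)}

/-- The density of `ω^n` in a chart. -/
def density (φ : OpenPartialHomeomorph X (Cn n)) (y : Cn n) : ℝ :=
  topCoeff ((g.form.pow n).inChart φ y)

theorem continuousOn_topCoeff_inChart {k : ℕ} {α : DForm n X k} (hα : α.IsSmooth)
    (hφ : φ ∈ atlas (Cn n) X) : ContinuousOn (fun y => topCoeff (α.inChart φ y)) φ.target :=
  (ContinuousAlternatingMap.apply ℝ _ ℝ (stdFrame n k)).continuous.comp_continuousOn
    (hα φ hφ).continuousOn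

theorem continuousOn_density (hφ : φ ∈ atlas (Cn n) X) :
    ContinuousOn (g.density φ) φ.target :=
  continuousOn_topCoeff_inChart (g.smooth.pow n) hφ

section

variable [IsManifold 𝓘(ℂ, Cn n) ω X]

theorem density_pos (hφ : φ ∈ atlas (Cn n) X) {y : Cn n} (hy : y ∈ φ.target) :
    0 < g.density φ y :=
  g.topCoeff_inChart_pos hφ hy

theorem density_eq (hφ : φ ∈ atlas (Cn n) X) (hψ : ψ ∈ atlas (Cn n) X) {y : Cn n}
    (hy : y ∈ φ.target) (hyψ : φ.symm y ∈ ψ.source) :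
    g.density φ y = (fderiv ℝ (fun z => ψ (φ.symm z)) y).det * g.density ψ (ψ (φ.symm y)) := by
  rw [density, DForm.inChart_eq_pullback _ hφ hψ hy hyψ, topCoeff_compContinuousLinearMap rfl]
  rfl

end

variable [MeasurableSpace X]

/-- The measure `ω^n` on the domain of a chart. -/
def chartMeasure (φ : OpenPartialHomeomorph X (Cn n)) : Measure X :=
  (((MeasureTheory.volume : Measure (Cn n)).restrict φ.target).withDensity fun y =>
    ENNReal.ofReal (g.density φ y)).map φ.symm

theorem volume_eq_iSup : g.volume = ⨆ φ ∈ atlas (Cn n) X, g.chartMeasure φ := rfl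

variable [BorelSpace X]

theorem chartMeasure_apply (φ : OpenPartialHomeomorph X (Cn n)) {A : Set X}
    (hA : MeasurableSet A) :
    g.chartMeasure φ A = ∫⁻ y in φ.target ∩ φ.symm ⁻¹' A, ENNReal.ofReal (g.density φ y) := by
  rw [chartMeasure, Measure.map_apply_of_aemeasurable (aemeasurable_symm φ _ _) hA,
    withDensity_apply', Measure.restrict_restrict' φ.open_target.measurableSet, Set.inter_comm]

variable [IsManifold 𝓘(ℂ, Cn n) ω X]

/-- Change of variables along the transition map. Only an inequality holds, since part of `A` may
lie outside the domain of `ψ`. -/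
theorem chartMeasure_le (hφ : φ ∈ atlas (Cn n) X) (hψ : ψ ∈ atlas (Cn n) X) {A : Set X}
    (hA : MeasurableSet A) (hAφ : A ⊆ φ.source) : g.chartMeasure ψ A ≤ g.chartMeasure φ A := by
  rw [chartMeasure_apply g ψ hA, chartMeasure_apply g φ hA]
  set S := ψ.target ∩ ψ.symm ⁻¹' A
  have hS : MeasurableSet S := measurableSet_target_inter_preimage ψ hA
  have h1 : ∫⁻ y in S, ENNReal.ofReal (g.density ψ y) =
      ∫⁻ y in S, ENNReal.ofReal |(fderiv ℝ (fun z => φ (ψ.symm z)) y).det| *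
        ENNReal.ofReal (g.density φ (φ (ψ.symm y))) := by
    refine setLIntegral_congr_fun hS fun y hy => ?_
    rw [g.density_eq hψ hφ hy.1 (hAφ hy.2), ← ENNReal.ofReal_mul (abs_nonneg _),
      abs_of_pos (det_transition_pos hψ hφ hy.1 (hAφ hy.2))]
  have hinj : Set.InjOn (fun z => φ (ψ.symm z)) S := by
    intro y hy z hz h
    exact ψ.symm.injOn hy.1 hz.1 (φ.injOn (hAφ hy.2) (hAφ hz.2) h)
  rw [h1, ← lintegral_image_eq_lintegral_abs_det_fderiv_mul MeasureTheory.volume hS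
    (fun y hy => ((contDiffAt_transition hψ hφ hy.1 (hAφ hy.2)).differentiableAt
      (by simp)).hasFDerivAt.hasFDerivWithinAt) hinj (fun y => ENNReal.ofReal (g.density φ y))]
  refine lintegral_mono_set ?_
  rintro _ ⟨y, hy, rfl⟩
  refine ⟨φ.map_source (hAφ hy.2), ?_⟩
  rw [Set.mem_preimage, φ.left_inv (hAφ hy.2)]
  exact hy.2

/-- By `chartMeasure_le` every chart measure is dominated by that of `φ` inside `φ.source`. Adding
the measure `⊤` on the complement turns this into a bound on all of `X`, which passes to the
supremum. -/
theorem volume_apply (hφ : φ ∈ atlas (Cn n) X) {A : Set X} (hA : MeasurableSet A)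
    (hAφ : A ⊆ φ.source) : g.volume A = g.chartMeasure φ A := by
  refine le_antisymm ?_ ?_
  · have h : g.volume ≤ g.chartMeasure φ + (⊤ : Measure X).restrict φ.sourceᶜ := by
      rw [volume_eq_iSup]
      refine iSup₂_le fun ψ hψ => Measure.le_iff.2 fun s hs => ?_
      have hsrc := φ.open_source.measurableSet
      rw [← measure_inter_add_sdiff s hsrc, Measure.add_apply, Measure.restrict_apply hs]
      refine add_le_add ((g.chartMeasure_le hφ hψ (hs.inter hsrc) Set.inter_subset_right).trans
        (measure_mono Set.inter_subset_left)) ?_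
      exact Measure.le_iff'.1 le_top _
    refine (Measure.le_iff'.1 h A).trans ?_
    rw [Measure.add_apply, Measure.restrict_apply hA]
    have : A ∩ φ.sourceᶜ = ∅ := by
      rw [← Set.sdiff_eq, Set.sdiff_eq_empty.2 hAφ]
    rw [this, measure_empty, add_zero]
  · rw [volume_eq_iSup]
    exact Measure.le_iff'.1 (le_iSup₂ (f := fun φ (_ : φ ∈ atlas (Cn n) X) => g.chartMeasure φ)
      φ hφ) A

theorem volume_restrict_source (hφ : φ ∈ atlas (Cn n) X) :
    g.volume.restrict φ.source = g.chartMeasure φ := by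
  ext s hs
  have hsrc := φ.open_source.measurableSet
  rw [Measure.restrict_apply hs, g.volume_apply hφ (hs.inter hsrc) Set.inter_subset_right,
    g.chartMeasure_apply φ (hs.inter hsrc), g.chartMeasure_apply φ hs]
  congr 2
  ext y
  constructor
  · exact fun h => ⟨h.1, h.2.1⟩
  · exact fun h => ⟨h.1, h.2, φ.map_target h.1⟩

theorem setIntegral_source (hφ : φ ∈ atlas (Cn n) X) {f : X → ℝ} (hf : Continuous f) :
    ∫ x in φ.source, f x ∂g.volume = ∫ y in φ.target, g.density φ y * f (φ.symm y) := by
  have hd : AEMeasurable (fun y => ENNReal.ofReal (g.density φ y))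
      ((MeasureTheory.volume : Measure (Cn n)).restrict φ.target) :=
    ((g.continuousOn_density hφ).aemeasurable φ.open_target.measurableSet).ennreal_ofReal
  rw [g.volume_restrict_source hφ, chartMeasure, integral_map (aemeasurable_symm φ _ _)
    hf.measurable.aestronglyMeasurable, integral_withDensity_eq_integral_toReal_smul₀ hd
      (Filter.Eventually.of_forall fun y => ENNReal.ofReal_lt_top)]
  refine setIntegral_congr_fun φ.open_target.measurableSet fun y hy => ?_
  simp only [smul_eq_mul]
  rw [ENNReal.toReal_ofReal (g.density_pos hφ hy).le]

theorem isLocallyFiniteMeasure_volume : IsLocallyFiniteMeasure g.volume := by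
  refine ⟨fun x => ?_⟩
  set φ := chartAt (Cn n) x
  have hφ : φ ∈ atlas (Cn n) X := chart_mem_atlas _ _
  have hx : x ∈ φ.source := mem_chart_source _ _
  obtain ⟨r, hr, hball⟩ := Metric.nhds_basis_closedBall.mem_iff.1
    (φ.open_target.mem_nhds (φ.map_source hx))
  have hO : IsOpen (φ.source ∩ φ ⁻¹' Metric.ball (φ x) r) :=
    φ.isOpen_inter_preimage Metric.isOpen_ball
  refine ⟨_, hO.mem_nhds ⟨hx, Metric.mem_ball_self hr⟩, ?_⟩
  rw [g.volume_apply hφ hO.measurableSet Set.inter_subset_left,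
    g.chartMeasure_apply φ hO.measurableSet]
  have hint : IntegrableOn (g.density φ) (Metric.closedBall (φ x) r) :=
    ((g.continuousOn_density hφ).mono hball).integrableOn_compact (isCompact_closedBall _ _)
  refine (lintegral_mono_set ?_).trans_lt hint.lintegral_lt_top
  intro y hy
  have := hy.2.2
  rw [Set.mem_preimage, φ.right_inv hy.1] at this
  exact Metric.ball_subset_closedBall this

/-- Needed for positivity of the total volume, and to turn integral bounds of a continuous function
into pointwise ones. -/
theorem volume_pos_of_isOpen {O : Set X} (hO : IsOpen O) (hne : O.Nonempty) :
    0 < g.volume O := by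
  obtain ⟨x, hx⟩ := hne
  set φ := chartAt (Cn n) x
  have hφ : φ ∈ atlas (Cn n) X := chart_mem_atlas _ _
  have hxs : x ∈ φ.source := mem_chart_source _ _
  have hA : IsOpen (O ∩ φ.source) := hO.inter φ.open_source
  refine lt_of_lt_of_le ?_ (measure_mono (Set.inter_subset_left (s := O) (t := φ.source)))
  rw [g.volume_apply hφ hA.measurableSet Set.inter_subset_right,
    g.chartMeasure_apply φ hA.measurableSet]
  have hT : IsOpen (φ.target ∩ φ.symm ⁻¹' (O ∩ φ.source)) := φ.symm.isOpen_inter_preimage hA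
  have hTne : (φ.target ∩ φ.symm ⁻¹' (O ∩ φ.source)).Nonempty :=
    ⟨φ x, φ.map_source hxs, by simp [φ.left_inv hxs, hx, hxs]⟩
  rw [pos_iff_ne_zero]
  intro h0
  have hd : AEMeasurable (fun y => ENNReal.ofReal (g.density φ y))
      ((MeasureTheory.volume : Measure (Cn n)).restrict
        (φ.target ∩ φ.symm ⁻¹' (O ∩ φ.source))) :=
    (((g.continuousOn_density hφ).mono Set.inter_subset_left).aemeasurable
      hT.measurableSet).ennreal_ofReal
  rw [lintegral_eq_zero_iff' hd, Filter.EventuallyEq, ae_restrict_iff' hT.measurableSet] at h0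
  refine (hT.measure_pos MeasureTheory.volume hTne).ne' (measure_mono_null (fun y hy => ?_) h0)
  intro h
  have := h hy
  simp only [Pi.zero_apply, ENNReal.ofReal_eq_zero] at this
  exact absurd (g.density_pos hφ hy.1) (not_lt.2 this)

end Volume

end HermitianMetric

/-! ### The Laplacian and the gradient in charts -/

section FlatFunctions

variable {n : ℕ}

theorem contDiffAt_flatFun {f : Cn n → ℝ} {y : Cn n} (hf : ContDiffAt ℝ ∞ f y) :
    ContDiffAt ℝ ∞ (flatFun f) y :=
  contDiffAt_constOfIsEmpty hf

theorem flatDc_congr {k : ℕ} {α β : Cn n → Cn n [⋀^Fin k]→L[ℝ] ℝ} {y : Cn n}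
    (h : α =ᶠ[nhds y] β) : flatDc α =ᶠ[nhds y] flatDc β := by
  filter_upwards [h.eventuallyEq_nhds] with z hz
  rw [flatDc, flatDc, Filter.EventuallyEq.extDeriv_eq]
  filter_upwards [hz] with t ht
  rw [ht]

theorem flatFun_congr {f f' : Cn n → ℝ} {y : Cn n} (h : f =ᶠ[nhds y] f') :
    flatFun f =ᶠ[nhds y] flatFun f' := by
  filter_upwards [h] with z hz
  rw [flatFun, flatFun, hz]

theorem flatFun_add (f f' : Cn n → ℝ) : flatFun (fun y => f y + f' y) = flatFun f + flatFun f' := by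
  funext y
  ext w
  rfl

theorem flatDc_flatFun_add {f f' : Cn n → ℝ} {y : Cn n} (hf : ContDiffAt ℝ ∞ f y)
    (hf' : ContDiffAt ℝ ∞ f' y) :
    flatDc (flatFun (fun y => f y + f' y)) y = flatDc (flatFun f) y + flatDc (flatFun f') y := by
  rw [flatDc_flatFun, flatDc_flatFun, flatDc_flatFun, flatFun_add, extDeriv_add
    ((contDiffAt_flatFun hf).differentiableAt (by simp))
    ((contDiffAt_flatFun hf').differentiableAt (by simp)), ← smul_add]
  rfl

theorem extDeriv_flatFun_comp {f : Cn n → ℝ} {y : Cn n} (hf : DifferentiableAt ℝ f y)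
    {G : ℝ → ℝ} {c : ℝ} (hG : HasDerivAt G c (f y)) :
    extDeriv (flatFun (fun z => G (f z))) y = c • extDeriv (flatFun f) y := by
  have h : fderiv ℝ (fun z => G (f z)) y = c • fderiv ℝ f y :=
    (hG.comp_hasFDerivAt y hf.hasFDerivAt).fderiv
  have h1 : extDeriv (flatFun (fun z => G (f z))) y = _ := extDeriv_constOfIsEmpty _ y
  have h2 : extDeriv (flatFun f) y = _ := extDeriv_constOfIsEmpty _ y
  rw [h1, h2, h]
  ext w
  rfl

theorem flatDc_flatFun_comp {f : Cn n → ℝ} {y : Cn n} (hf : DifferentiableAt ℝ f y)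
    {G : ℝ → ℝ} {c : ℝ} (hG : HasDerivAt G c (f y)) :
    flatDc (flatFun (fun z => G (f z))) y = c • flatDc (flatFun f) y := by
  rw [flatDc_flatFun, flatDc_flatFun, extDeriv_flatFun_comp hf hG, smul_comm]
  rfl

/-- Apply `d` to `d^c G(f) = G'(f) d^c f`, which holds near `y`. -/
theorem extDeriv_flatDc_flatFun_comp {f : Cn n → ℝ} {y : Cn n} (hf : ContDiffAt ℝ ∞ f y)
    {G G' G'' : ℝ → ℝ} (hG : ∀ t, HasDerivAt G (G' t) t) (hG' : ∀ t, HasDerivAt G' (G'' t) t) :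
    extDeriv (flatDc (flatFun (fun z => G (f z)))) y =
      G' (f y) • extDeriv (flatDc (flatFun f)) y +
        G'' (f y) • wedge (extDeriv (flatFun f) y) (flatDc (flatFun f) y) := by
  have hev : ∀ᶠ z in nhds y, DifferentiableAt ℝ f z := by
    filter_upwards [(hf.of_le (m := 1) (by simp)).eventually (by simp)] with z hz
    exact hz.differentiableAt (by simp)
  have h1 : flatDc (flatFun (fun z => G (f z))) =ᶠ[nhds y]
      fun z => G' (f z) • flatDc (flatFun f) z := by
    filter_upwards [hev] with z hz
    exact flatDc_flatFun_comp hz (hG _)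
  have hd := hf.differentiableAt (by simp)
  rw [h1.extDeriv_eq]
  ext v
  rw [extDeriv_smul_apply (f := fun z => G' (f z)) (((hG' _).differentiableAt).comp y hd)
    ((contDiffAt_flatDc (contDiffAt_flatFun hf)).differentiableAt (by simp)), add_comm]
  have h2 := extDeriv_flatFun_comp hd (hG' (f y))
  change _ + wedge (extDeriv (flatFun (fun z => G' (f z))) y) (flatDc (flatFun f) y) v = _
  rw [h2, wedge_smul_left]
  rfl

end FlatFunctions

namespace HermitianMetric

section Operators

variable {n : ℕ} {X : Type*} [TopologicalSpace X] [ChartedSpace (Cn n) X]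
  (g : HermitianMetric n X) {φ : OpenPartialHomeomorph X (Cn n)}

/-- The function `dd^c ω^{n-1} / ω^n`. -/
def torsion (x : X) : ℝ := (g.form.pow (n - 1)).ddc.coeffAt x / (g.form.pow n).coeffAt x

theorem coeffAt_pow_pos (x : X) : 0 < (g.form.pow n).coeffAt x :=
  topCoeff_wedgePow_pos _ (g.invariant x) (g.pos x)

theorem abs_torsion_le {B : ℝ} (hB : g.DdcBound B) (x : X) : |g.torsion x| ≤ B := by
  have h := g.coeffAt_pow_pos x
  rw [torsion, abs_div, abs_of_pos h, div_le_iff₀ h, abs_le]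
  exact ⟨by linarith [(hB x).1], (hB x).2⟩

variable [IsManifold 𝓘(ℂ, Cn n) ω X]

/-- The coefficient of a single form depends on the preferred chart, which need not vary
continuously with the point; in the quotient this dependence cancels, and one chart serves a whole
neighbourhood. -/
theorem continuous_coeffAt_div {k : ℕ} (hk : k = 2 * n) {α : DForm n X k} (hα : α.IsSmooth) :
    Continuous fun x => α.coeffAt x / (g.form.pow n).coeffAt x := by
  rw [continuous_iff_continuousAt]
  intro x
  set φ := chartAt (Cn n) x
  have hφ : φ ∈ atlas (Cn n) X := chart_mem_atlas _ _
  have hx : x ∈ φ.source := mem_chart_source _ _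
  have h1 : (fun x => α.coeffAt x / (g.form.pow n).coeffAt x) =ᶠ[nhds x]
      (fun y => topCoeff (α.inChart φ y) / g.density φ y) ∘ φ := by
    filter_upwards [φ.open_source.mem_nhds hx] with z hz
    have := DForm.coeffAt_div_eq hk rfl α (g.form.pow n) hφ (φ.map_source hz)
    rwa [φ.left_inv hz] at this
  refine ContinuousAt.congr (ContinuousAt.comp ?_ (φ.continuousAt hx)) h1.symm
  have hnh := φ.open_target.mem_nhds (φ.map_source hx)
  exact ((continuousOn_topCoeff_inChart hα hφ).continuousAt hnh).div
    ((g.continuousOn_density hφ).continuousAt hnh) (g.density_pos hφ (φ.map_source hx)).ne'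

theorem continuous_laplacian (hn : 1 ≤ n) {f : X → ℝ} (hf : IsSmoothFun n f) :
    Continuous (g.laplacian f) := by
  have := g.continuous_coeffAt_div (k := 0 + 2 + 2 * (n - 1)) (by omega)
    ((isSmooth_ofFun hf).ddc.wedge (g.smooth.pow (n - 1)))
  refine (continuous_const (y := (n : ℝ)).mul this).congr fun x => ?_
  rw [laplacian, mul_div_assoc]
  rfl

theorem continuous_torsion (hn : 1 ≤ n) : Continuous g.torsion :=
  g.continuous_coeffAt_div (k := 2 * (n - 1) + 2) (by omega) (g.smooth.pow (n - 1)).ddc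

theorem density_mul_laplacian (hn : 1 ≤ n) {f : X → ℝ} (hf : IsSmoothFun n f)
    (hφ : φ ∈ atlas (Cn n) X) {y : Cn n} (hy : y ∈ φ.target) :
    g.density φ y * g.laplacian f (φ.symm y) =
      n * topCoeff (wedge (extDeriv (flatDc (flatFun (f ∘ φ.symm))) y)
        ((g.form.pow (n - 1)).inChart φ y)) := by
  have h := DForm.coeffAt_div_eq (k := 0 + 2 + 2 * (n - 1)) (by omega) rfl
    ((ofFun n f).ddc.wedge (g.form.pow (n - 1))) (g.form.pow n) hφ hy
  rw [laplacian, mul_div_assoc, h, DForm.inChart_wedge,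
    DForm.inChart_ddc (isSmooth_ofFun hf) hφ hy, inChart_ofFun]
  have := (g.density_pos hφ hy).ne'
  rw [density] at this ⊢
  field_simp

theorem density_mul_gradSq (hn : 1 ≤ n) {f : X → ℝ} (hf : IsSmoothFun n f)
    (hφ : φ ∈ atlas (Cn n) X) {y : Cn n} (hy : y ∈ φ.target) :
    g.density φ y * g.gradSq f (φ.symm y) =
      n * topCoeff (wedge (wedge (extDeriv (flatFun (f ∘ φ.symm)) y)
        (flatDc (flatFun (f ∘ φ.symm)) y)) ((g.form.pow (n - 1)).inChart φ y)) := by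
  have h := DForm.coeffAt_div_eq (k := 0 + 1 + (0 + 1) + 2 * (n - 1)) (by omega) rfl
    (((ofFun n f).d.wedge (ofFun n f).dc).wedge (g.form.pow (n - 1))) (g.form.pow n) hφ hy
  rw [gradSq, mul_div_assoc, h, DForm.inChart_wedge, DForm.inChart_wedge,
    DForm.inChart_d (isSmooth_ofFun hf) hφ hy,
    DForm.inChart_dc (isSmooth_ofFun hf) hφ hy, inChart_ofFun]
  have := (g.density_pos hφ hy).ne'
  rw [density] at this ⊢
  field_simp

theorem density_mul_torsion (hn : 1 ≤ n) (hφ : φ ∈ atlas (Cn n) X) {y : Cn n}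
    (hy : y ∈ φ.target) :
    g.density φ y * g.torsion (φ.symm y) =
      topCoeff (extDeriv (flatDc ((g.form.pow (n - 1)).inChart φ)) y) := by
  have h := DForm.coeffAt_div_eq (k := 2 * (n - 1) + 2) (by omega) rfl
    (g.form.pow (n - 1)).ddc (g.form.pow n) hφ hy
  rw [torsion, h, DForm.inChart_ddc (g.smooth.pow (n - 1)) hφ hy]
  have := (g.density_pos hφ hy).ne'
  rw [density] at this ⊢
  field_simp

/-- To compare functions at `x`, it suffices to compare densities in the chart at `x`. -/
theorem eq_of_density_mul_eq {x : X} {a b : ℝ}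
    (h : g.density (chartAt (Cn n) x) (chartAt (Cn n) x x) * a =
      g.density (chartAt (Cn n) x) (chartAt (Cn n) x x) * b) : a = b :=
  mul_left_cancel₀ (g.density_pos (chart_mem_atlas _ _) (mem_chart_target _ _)).ne' h

theorem contDiffAt_comp_chartAt_symm {f : X → ℝ} (hf : IsSmoothFun n f) (x : X) :
    ContDiffAt ℝ ∞ (f ∘ (chartAt (Cn n) x).symm) (chartAt (Cn n) x x) :=
  (contDiffOn_comp_symm hf (chart_mem_atlas _ _)).contDiffAt
    ((chartAt (Cn n) x).open_target.mem_nhds (mem_chart_target _ _))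

theorem laplacian_chartAt (hn : 1 ≤ n) {f : X → ℝ} (hf : IsSmoothFun n f) (x : X) :
    g.density (chartAt (Cn n) x) (chartAt (Cn n) x x) * g.laplacian f x =
      n * topCoeff (wedge
        (extDeriv (flatDc (flatFun (f ∘ (chartAt (Cn n) x).symm))) (chartAt (Cn n) x x))
        ((g.form.pow (n - 1)).inChart (chartAt (Cn n) x) (chartAt (Cn n) x x))) := by
  have := g.density_mul_laplacian hn hf (chart_mem_atlas (Cn n) x) (mem_chart_target (Cn n) x)
  rwa [OpenPartialHomeomorph.left_inv _ (mem_chart_source (Cn n) x)] at this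

theorem gradSq_chartAt (hn : 1 ≤ n) {f : X → ℝ} (hf : IsSmoothFun n f) (x : X) :
    g.density (chartAt (Cn n) x) (chartAt (Cn n) x x) * g.gradSq f x =
      n * topCoeff (wedge (wedge
        (extDeriv (flatFun (f ∘ (chartAt (Cn n) x).symm)) (chartAt (Cn n) x x))
        (flatDc (flatFun (f ∘ (chartAt (Cn n) x).symm)) (chartAt (Cn n) x x)))
        ((g.form.pow (n - 1)).inChart (chartAt (Cn n) x) (chartAt (Cn n) x x))) := by
  have := g.density_mul_gradSq hn hf (chart_mem_atlas (Cn n) x) (mem_chart_target (Cn n) x)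
  rwa [OpenPartialHomeomorph.left_inv _ (mem_chart_source (Cn n) x)] at this

theorem laplacian_comp (hn : 1 ≤ n) {f : X → ℝ} (hf : IsSmoothFun n f) {G G' G'' : ℝ → ℝ}
    (hG : ∀ t, HasDerivAt G (G' t) t) (hG' : ∀ t, HasDerivAt G' (G'' t) t)
    (hGf : IsSmoothFun n fun x => G (f x)) (x : X) :
    g.laplacian (fun x => G (f x)) x =
      G' (f x) * g.laplacian f x + G'' (f x) * g.gradSq f x := by
  apply g.eq_of_density_mul_eq (x := x)
  have h := extDeriv_flatDc_flatFun_comp (contDiffAt_comp_chartAt_symm hf x) hG hG'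
  have hx : (f ∘ (chartAt (Cn n) x).symm) (chartAt (Cn n) x x) = f x := by
    rw [Function.comp_apply, OpenPartialHomeomorph.left_inv _ (mem_chart_source (Cn n) x)]
  rw [hx] at h
  have h1 := g.laplacian_chartAt hn hf x
  have h2 := g.gradSq_chartAt hn hf x
  rw [g.laplacian_chartAt hn hGf x]
  change (n : ℝ) * topCoeff (wedge (extDeriv (flatDc (flatFun
    (fun z => G ((f ∘ (chartAt (Cn n) x).symm) z)))) (chartAt (Cn n) x x)) _) = _
  rw [h]
  have h3 := wedge_add_left (G' (f x) • extDeriv (flatDc (flatFun (f ∘ (chartAt (Cn n) x).symm)))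
    (chartAt (Cn n) x x)) (G'' (f x) • wedge
      (extDeriv (flatFun (f ∘ (chartAt (Cn n) x).symm)) (chartAt (Cn n) x x))
      (flatDc (flatFun (f ∘ (chartAt (Cn n) x).symm)) (chartAt (Cn n) x x)))
    ((g.form.pow (n - 1)).inChart (chartAt (Cn n) x) (chartAt (Cn n) x x))
  rw [h3, wedge_smul_left, wedge_smul_left]
  simp only [topCoeff, ContinuousAlternatingMap.add_apply, ContinuousAlternatingMap.smul_apply,
    smul_eq_mul] at h1 h2 ⊢
  linear_combination -(G' (f x)) * h1 - G'' (f x) * h2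

theorem gradSq_comp (hn : 1 ≤ n) {f : X → ℝ} (hf : IsSmoothFun n f) {G G' : ℝ → ℝ}
    (hG : ∀ t, HasDerivAt G (G' t) t) (hGf : IsSmoothFun n fun x => G (f x)) (x : X) :
    g.gradSq (fun x => G (f x)) x = G' (f x) ^ 2 * g.gradSq f x := by
  apply g.eq_of_density_mul_eq (x := x)
  have hd := (contDiffAt_comp_chartAt_symm hf x).differentiableAt (by simp)
  have h := extDeriv_flatFun_comp hd (hG _)
  have h' := flatDc_flatFun_comp hd (hG _)
  have hx : (f ∘ (chartAt (Cn n) x).symm) (chartAt (Cn n) x x) = f x := by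
    rw [Function.comp_apply, OpenPartialHomeomorph.left_inv _ (mem_chart_source (Cn n) x)]
  rw [hx] at h h'
  have h2 := g.gradSq_chartAt hn hf x
  rw [g.gradSq_chartAt hn hGf x]
  change (n : ℝ) * topCoeff (wedge (wedge (extDeriv (flatFun
    (fun z => G ((f ∘ (chartAt (Cn n) x).symm) z))) (chartAt (Cn n) x x)) (flatDc (flatFun
    (fun z => G ((f ∘ (chartAt (Cn n) x).symm) z))) (chartAt (Cn n) x x))) _) = _
  rw [h, h', wedge_smul_left, wedge_smul_right, wedge_smul_left, wedge_smul_left]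
  simp only [topCoeff, ContinuousAlternatingMap.smul_apply, smul_eq_mul] at h2 ⊢
  linear_combination -(G' (f x)) ^ 2 * h2

theorem laplacian_add (hn : 1 ≤ n) {f f' : X → ℝ} (hf : IsSmoothFun n f)
    (hf' : IsSmoothFun n f') (x : X) :
    g.laplacian (fun x => f x + f' x) x = g.laplacian f x + g.laplacian f' x := by
  have hadd : IsSmoothFun n fun x => f x + f' x := ContMDiff.add hf hf'
  apply g.eq_of_density_mul_eq (x := x)
  have hc := contDiffAt_comp_chartAt_symm hf x
  have hc' := contDiffAt_comp_chartAt_symm hf' x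
  have h1 := g.laplacian_chartAt hn hf x
  have h2 := g.laplacian_chartAt hn hf' x
  have hev : flatDc (flatFun ((fun x => f x + f' x) ∘ (chartAt (Cn n) x).symm))
      =ᶠ[nhds (chartAt (Cn n) x x)] flatDc (flatFun (f ∘ (chartAt (Cn n) x).symm)) +
        flatDc (flatFun (f' ∘ (chartAt (Cn n) x).symm)) := by
    filter_upwards [(chartAt (Cn n) x).open_target.mem_nhds (mem_chart_target _ _)] with z hz
    have hnz := (chartAt (Cn n) x).open_target.mem_nhds hz
    exact flatDc_flatFun_add
      ((contDiffOn_comp_symm hf (chart_mem_atlas _ _)).contDiffAt hnz)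
      ((contDiffOn_comp_symm hf' (chart_mem_atlas _ _)).contDiffAt hnz)
  rw [g.laplacian_chartAt hn hadd x, hev.extDeriv_eq, extDeriv_add
    ((contDiffAt_flatDc (contDiffAt_flatFun hc)).differentiableAt (by simp))
    ((contDiffAt_flatDc (contDiffAt_flatFun hc')).differentiableAt (by simp)),
    wedge_add_left]
  simp only [topCoeff, ContinuousAlternatingMap.add_apply] at h1 h2 ⊢
  linear_combination -h1 - h2

theorem laplacian_eq_zero (hn : 1 ≤ n) {f : X → ℝ} (hf : IsSmoothFun n f) {x : X}
    (hx : x ∉ tsupport f) : g.laplacian f x = 0 := by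
  apply g.eq_of_density_mul_eq (x := x)
  have h0 : f ∘ (chartAt (Cn n) x).symm =ᶠ[nhds (chartAt (Cn n) x x)] fun _ => 0 := by
    have hc := (chartAt (Cn n) x).continuousAt_symm (mem_chart_target (Cn n) x)
    rw [ContinuousAt, OpenPartialHomeomorph.left_inv _ (mem_chart_source (Cn n) x)] at hc
    filter_upwards [hc.eventually (notMem_tsupport_iff_eventuallyEq.1 hx)] with z hz using hz
  have h1 : flatFun (fun _ : Cn n => (0 : ℝ)) = 0 := by
    funext z; ext w; rfl
  have h2 : flatDc (0 : Cn n → Cn n [⋀^Fin 0]→L[ℝ] ℝ) = 0 := by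
    funext z
    rw [← h1, flatDc_flatFun, h1, extDeriv_zero_form]
    ext w
    simp
  have h3 := flatDc_congr (flatFun_congr h0)
  rw [h1, h2] at h3
  rw [g.laplacian_chartAt hn hf x, h3.extDeriv_eq, extDeriv_zero_form, ← wedgeL_apply, map_zero]
  simp [topCoeff]

end Operators

end HermitianMetric

namespace HermitianMetric

/-! ### Integration by parts on compact manifolds -/

section IntegrationByParts

variable {n : ℕ} {X : Type*} [TopologicalSpace X] [CompactSpace X]
  [ChartedSpace (Cn n) X] [IsManifold 𝓘(ℂ, Cn n) ω X] [MeasurableSpace X] [BorelSpace X]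
  (g : HermitianMetric n X) {φ : OpenPartialHomeomorph X (Cn n)}

theorem isFiniteMeasure_volume : IsFiniteMeasure g.volume := by
  have := g.isLocallyFiniteMeasure_volume
  infer_instance

theorem integrable_of_continuous {f : X → ℝ} (hf : Continuous f) : Integrable f g.volume := by
  have := g.isFiniteMeasure_volume
  exact hf.integrable_of_hasCompactSupport (HasCompactSupport.of_compactSpace f)

theorem integral_laplacian_of_tsupport_subset (hn : 1 ≤ n) {f : X → ℝ} (hf : IsSmoothFun n f)
    (hφ : φ ∈ atlas (Cn n) X) (hfφ : tsupport f ⊆ φ.source) :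
    ∫ x, g.laplacian f x ∂g.volume = n * ∫ x, f x * g.torsion x ∂g.volume := by
  classical
  have hl : ∫ x, g.laplacian f x ∂g.volume = ∫ x in φ.source, g.laplacian f x ∂g.volume :=
    (setIntegral_eq_integral_of_forall_compl_eq_zero fun x hx =>
      g.laplacian_eq_zero hn hf fun h => hx (hfφ h)).symm
  have hr : ∫ x, f x * g.torsion x ∂g.volume = ∫ x in φ.source, f x * g.torsion x ∂g.volume :=
    (setIntegral_eq_integral_of_forall_compl_eq_zero fun x hx => by
      rw [image_eq_zero_of_notMem_tsupport fun h => hx (hfφ h), zero_mul]).symm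
  have hfc : Continuous f := ContMDiff.continuous hf
  have hft : Continuous fun x => f x * g.torsion x := hfc.mul (g.continuous_torsion hn)
  rw [hl, hr, g.setIntegral_source hφ (g.continuous_laplacian hn hf), g.setIntegral_source hφ hft]
  -- The chart expression of `f` extended by zero. It is smooth on `ℂⁿ` because `tsupport f` has
  -- compact, hence closed, image inside `φ.target`.
  let F : Cn n → ℝ := fun y => if y ∈ φ.target then f (φ.symm y) else 0
  have hF : ∀ y ∈ φ.target, F =ᶠ[nhds y] f ∘ φ.symm := fun y hy => by
    filter_upwards [φ.open_target.mem_nhds hy] with z hz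
    simp [F, hz]
  have hK : IsCompact (φ '' tsupport f) :=
    (isClosed_tsupport f).isCompact.image_of_continuousOn (φ.continuousOn.mono hfφ)
  have hFs : Function.support F ⊆ φ '' tsupport f := by
    intro y hy
    by_cases hyt : y ∈ φ.target
    · refine ⟨φ.symm y, subset_closure ?_, φ.right_inv hyt⟩
      simpa [F, hyt] using hy
    · simp [F, hyt] at hy
  have hFt : tsupport F ⊆ φ '' tsupport f := closure_minimal hFs hK.isClosed
  have hKt : φ '' tsupport f ⊆ φ.target := by
    rintro _ ⟨x, hx, rfl⟩
    exact φ.map_source (hfφ hx)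
  have hFd : ContDiff ℝ ∞ F := contDiff_of_contDiffAt_tsupport fun y hy =>
    ((contDiffOn_comp_symm hf hφ).contDiffAt
      (φ.open_target.mem_nhds (hKt (hFt hy)))).congr_of_eventuallyEq (hF y (hKt (hFt hy)))
  have key := integral_topCoeff_ddc_wedge (k := 2 * (n - 1)) (by omega) φ.open_target hFd
    (hK.of_isClosed_subset (isClosed_tsupport F) hFt) (hFt.trans hKt)
    ((g.smooth.pow (n - 1)) φ hφ) (fun z hz => g.inChart_pow_invariant hφ hz (n - 1))
  have h1 : ∫ y in φ.target, g.density φ y * g.laplacian f (φ.symm y) =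
      n * ∫ y in φ.target, topCoeff (wedge (extDeriv (flatDc (flatFun F)) y)
        ((g.form.pow (n - 1)).inChart φ y)) := by
    rw [← integral_const_mul]
    refine setIntegral_congr_fun φ.open_target.measurableSet fun y hy => ?_
    rw [g.density_mul_laplacian hn hf hφ hy,
      (flatDc_congr (flatFun_congr (hF y hy))).extDeriv_eq]
  have h2 : ∫ y in φ.target, g.density φ y * (f (φ.symm y) * g.torsion (φ.symm y)) =
      ∫ y in φ.target, F y * topCoeff (extDeriv (flatDc ((g.form.pow (n - 1)).inChart φ)) y) := by
    refine setIntegral_congr_fun φ.open_target.measurableSet fun y hy => ?_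
    rw [← g.density_mul_torsion hn hφ hy]
    simp only [F, if_pos hy]
    ring
  rw [h1, h2, key]

variable [T2Space X]

/-- The formula `∫ dd^c f ∧ ω^{n-1} = ∫ f dd^c ω^{n-1}`. -/
theorem integral_laplacian (hn : 1 ≤ n) {f : X → ℝ} (hf : IsSmoothFun n f) :
    ∫ x, g.laplacian f x ∂g.volume = n * ∫ x, f x * g.torsion x ∂g.volume := by
  have := isManifold_real n X
  obtain ⟨ρ, hρ⟩ := SmoothPartitionOfUnity.exists_isSubordinate_chartAt_source 𝓘(ℝ, Cn n) X
  -- On a compact space only finitely many members of the partition are nonzero, so `f` is a finite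
  -- sum of functions supported in charts.
  have hfin : {i | (Function.support (ρ i)).Nonempty}.Finite :=
    ρ.locallyFinite.finite_nonempty_of_compact
  have hsum : ∀ s : Finset X, IsSmoothFun n (fun x => ∑ i ∈ s, ρ i x * f x) ∧
      ∫ x, g.laplacian (fun x => ∑ i ∈ s, ρ i x * f x) x ∂g.volume =
        n * ∫ x, (∑ i ∈ s, ρ i x * f x) * g.torsion x ∂g.volume := by
    classical
    intro s
    induction s using Finset.induction_on with
    | empty =>
      have h0 : IsSmoothFun n (fun _ : X => (0 : ℝ)) := contMDiff_const
      refine ⟨by simpa using h0, ?_⟩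
      simp only [Finset.sum_empty, zero_mul, integral_zero, mul_zero]
      refine integral_eq_zero_of_ae (Filter.Eventually.of_forall fun x => ?_)
      exact g.laplacian_eq_zero hn h0 (by simp [tsupport])
    | insert i s hi ih =>
      have hs : IsSmoothFun n (fun x => ρ i x * f x) := (ρ i).contMDiff.mul hf
      have hsc : Continuous fun x => ρ i x * f x := ContMDiff.continuous hs
      have hssc : Continuous fun x => ∑ i ∈ s, ρ i x * f x := ContMDiff.continuous ih.1
      have hti := g.continuous_torsion hn
      simp only [Finset.sum_insert hi]
      refine ⟨ContMDiff.add hs ih.1, ?_⟩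
      have hsub : tsupport (fun x => ρ i x * f x) ⊆ (chartAt (Cn n) i).source :=
        (closure_mono (Function.support_mul_subset_left _ _)).trans (hρ i)
      have i1 : Integrable (fun x => ρ i x * f x * g.torsion x) g.volume :=
        g.integrable_of_continuous (hsc.mul hti)
      have i2 : Integrable (fun x => (∑ i ∈ s, ρ i x * f x) * g.torsion x) g.volume :=
        g.integrable_of_continuous (hssc.mul hti)
      simp_rw [g.laplacian_add hn hs ih.1, add_mul]
      rw [integral_add (g.integrable_of_continuous (g.continuous_laplacian hn hs))
        (g.integrable_of_continuous (g.continuous_laplacian hn ih.1)),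
        integral_add i1 i2, ih.2,
        g.integral_laplacian_of_tsupport_subset hn hs (chart_mem_atlas (Cn n) i) hsub, mul_add]
  have hf' : (fun x => ∑ i ∈ hfin.toFinset, ρ i x * f x) = f := by
    funext x
    rw [← Finset.sum_mul, ← finsum_eq_sum_of_support_subset, ρ.sum_eq_one (Set.mem_univ x), one_mul]
    intro i hi
    simp only [Set.Finite.coe_toFinset, Set.mem_ofPred_eq]
    exact ⟨x, hi⟩
  have h := (hsum hfin.toFinset).2
  rwa [hf', show (fun x => (∑ i ∈ hfin.toFinset, ρ i x * f x) * g.torsion x) =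
    fun x => f x * g.torsion x from funext fun x => by rw [congrFun hf' x]] at h

/-- The integral formula for `f = 1`. It is what allows an arbitrary constant to be subtracted from
`e^{pw}` in the energy identity. -/
theorem integral_torsion (hn : 1 ≤ n) : ∫ x, g.torsion x ∂g.volume = 0 := by
  have h1 : IsSmoothFun n (fun _ : X => (1 : ℝ)) := contMDiff_const
  have hx : IsSmoothFun n (fun _ : X => (0 : ℝ)) := contMDiff_const
  have h2 := g.integral_laplacian hn h1
  have h3 : ∀ x, g.laplacian (fun _ : X => (1 : ℝ)) x = 0 := fun x => by
    have := g.laplacian_comp hn hx (G := fun _ => 1) (G' := fun _ => 0) (G'' := fun _ => 0)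
      (fun t => hasDerivAt_const t 1) (fun t => hasDerivAt_const t 0) h1 x
    simpa using this
  simp only [h3, integral_zero, one_mul] at h2
  have hn' : (n : ℝ) ≠ 0 := by positivity
  exact (mul_eq_zero.1 h2.symm).resolve_left hn'

end IntegrationByParts

/-! ### Energy identities for the kernel of the adjoint of the Laplacian -/

section Energy

theorem isSmoothFun_exp {n : ℕ} {X : Type*} [TopologicalSpace X] [ChartedSpace (Cn n) X]
    {w : X → ℝ} (hw : IsSmoothFun n w) (p : ℝ) :
    IsSmoothFun n fun x => Real.exp (p * w x) :=
  ContDiff.comp_contMDiff (g := fun t => Real.exp (p * t)) (by fun_prop) hw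

theorem hasDerivAt_exp_mul (p t : ℝ) :
    HasDerivAt (fun t => Real.exp (p * t)) (p * Real.exp (p * t)) t := by
  have := ((hasDerivAt_id t).const_mul p).exp
  simpa [mul_comm] using this

theorem gradSq_exp_sub_const {n : ℕ} {X : Type*} [TopologicalSpace X] [ChartedSpace (Cn n) X]
    [IsManifold 𝓘(ℂ, Cn n) ω X] (g : HermitianMetric n X) {w : X → ℝ} (hn : 1 ≤ n)
    (hw : IsSmoothFun n w) (p m : ℝ) (x : X) :
    g.gradSq (fun x => Real.exp (p * w x) - m) x =
      p ^ 2 * (Real.exp (2 * p * w x) * g.gradSq w x) := by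
  rw [g.gradSq_comp hn hw (G := fun t => Real.exp (p * t) - m)
    (fun t => (hasDerivAt_exp_mul p t).sub_const m)
    (ContDiff.comp_contMDiff (g := fun t => Real.exp (p * t) - m) (by fun_prop) hw),
    mul_pow, ← Real.exp_nat_mul]
  push_cast
  ring_nf

variable {n : ℕ} {X : Type*} [TopologicalSpace X] [T2Space X] [CompactSpace X]
  [ChartedSpace (Cn n) X] [IsManifold 𝓘(ℂ, Cn n) ω X] [MeasurableSpace X] [BorelSpace X]
  (g : HermitianMetric n X) {w : X → ℝ}

/-- If `e^w` is in the kernel of `Δ^*`, then `∫ p e^{pw} |dw|² = n ∫ (e^{pw} - c) dd^c ω^{n-1}`. -/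
theorem mul_integral_exp_mul_gradSq (hn : 1 ≤ n) (hw : IsSmoothFun n w)
    (hker : g.InKerLaplacianAdjoint fun x => Real.exp (w x)) (p c : ℝ) :
    p * ∫ x, Real.exp (p * w x) * g.gradSq w x ∂g.volume =
      n * ∫ x, (Real.exp (p * w x) - c) * g.torsion x ∂g.volume := by
  -- `F' = p e^{(p-1)t}` makes `e^w Δ F(w)` carry the same `Δw` term as `Δ e^{pw}`, while the
  -- gradient coefficients are `p(p-1)` and `p²`; their difference is `p`. At `p = 1` the
  -- antiderivative degenerates to the identity.
  obtain ⟨F, hF, hFw⟩ : ∃ F : ℝ → ℝ, (∀ t, HasDerivAt F (p * Real.exp ((p - 1) * t)) t) ∧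
      IsSmoothFun n fun x => F (w x) := by
    rcases eq_or_ne p 1 with rfl | hp
    · exact ⟨id, fun t => by simpa using hasDerivAt_id t, hw⟩
    · have hp' : p - 1 ≠ 0 := sub_ne_zero.2 hp
      refine ⟨fun t => p / (p - 1) * Real.exp ((p - 1) * t), fun t => ?_, ?_⟩
      · have := (hasDerivAt_exp_mul (p - 1) t).const_mul (p / (p - 1))
        convert! this using 1
        field_simp
      · exact ContDiff.comp_contMDiff (g := fun t => p / (p - 1) * Real.exp ((p - 1) * t))
          (by fun_prop) hw
  have hwc : Continuous w := ContMDiff.continuous hw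
  have hE := isSmoothFun_exp hw p
  have hpt : ∀ x, p * (Real.exp (p * w x) * g.gradSq w x) =
      g.laplacian (fun x => Real.exp (p * w x)) x -
        Real.exp (w x) * g.laplacian (fun x => F (w x)) x := by
    intro x
    rw [g.laplacian_comp hn hw (G := fun t => Real.exp (p * t)) (hasDerivAt_exp_mul p)
      (fun t => (hasDerivAt_exp_mul p t).const_mul p) hE,
      g.laplacian_comp hn hw hF (fun t => (hasDerivAt_exp_mul (p - 1) t).const_mul p) hFw]
    have : Real.exp (p * w x) = Real.exp (w x) * Real.exp ((p - 1) * w x) := by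
      rw [← Real.exp_add]; ring_nf
    rw [this]
    ring
  have hi1 := g.integrable_of_continuous (g.continuous_laplacian hn hE)
  have hi2 : Integrable (fun x => Real.exp (w x) * g.laplacian (fun x => F (w x)) x) g.volume :=
    g.integrable_of_continuous ((Real.continuous_exp.comp hwc).mul
      (g.continuous_laplacian hn hFw))
  have ht := g.continuous_torsion hn
  have hi3 : Integrable (fun x => Real.exp (p * w x) * g.torsion x) g.volume :=
    g.integrable_of_continuous (by fun_prop)
  rw [← integral_const_mul]
  simp_rw [hpt, sub_mul]
  rw [integral_sub hi1 hi2, integral_sub hi3 ((g.integrable_of_continuous ht).const_mul c),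
    integral_const_mul, g.integral_torsion hn, g.integral_laplacian hn hE]
  have := hker.2 _ hFw
  rw [this]
  ring

/-- The constant `c` stays free: it is later the square of a mean in the Poincaré step and `0` in
the Moser step. The absolute value on the left covers both signs of `p`. -/
theorem abs_mul_integral_exp_mul_gradSq_le (hn : 1 ≤ n) (hw : IsSmoothFun n w)
    (hker : g.InKerLaplacianAdjoint fun x => Real.exp (w x)) {B : ℝ} (hB : g.DdcBound B)
    (p c : ℝ) :
    |p * ∫ x, Real.exp (p * w x) * g.gradSq w x ∂g.volume| ≤
      n * |B| * ∫ x, |Real.exp (p * w x) - c| ∂g.volume := by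
  have hwc : Continuous w := ContMDiff.continuous hw
  rw [g.mul_integral_exp_mul_gradSq hn hw hker p c, abs_mul, Nat.abs_cast, mul_assoc,
    ← integral_const_mul]
  refine mul_le_mul_of_nonneg_left ?_ (by positivity)
  refine (abs_integral_le_integral_abs).trans (integral_mono ?_ ?_ fun x => ?_)
  · have := g.continuous_torsion hn
    exact g.integrable_of_continuous (by fun_prop)
  · exact g.integrable_of_continuous (by fun_prop)
  · simp only [abs_mul]
    rw [mul_comm]
    exact mul_le_mul_of_nonneg_right ((g.abs_torsion_le hB x).trans (le_abs_self B))
      (abs_nonneg _)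

end Energy

end HermitianMetric

/-! ### Exponential moments: growth and Moser iteration -/

section Growth

/-- A function with `a p ≤ a (p / 2) ^ 2 + K p ^ 2 a p` which is `1 + O(p²)` at `0` is bounded by
`exp (4 K p ^ 2)`, whatever the constant in the `O(p²)`. -/
theorem le_exp_of_le_sq_half {a : ℝ → ℝ} {K L : ℝ} (hK : 0 ≤ K) (ha : ∀ p, 0 ≤ a p)
    (hstep : ∀ p, a p ≤ a (p / 2) ^ 2 + K * p ^ 2 * a p)
    (hbase : ∀ p, |p| * L ≤ 1 → a p ≤ Real.exp (L ^ 2 * p ^ 2)) {p : ℝ} (hp : K * p ^ 2 ≤ 1 / 2) :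
    a p ≤ Real.exp (4 * K * p ^ 2) := by
  -- Halving `p` and squaring turns an exponent coefficient `κ` into `κ / 2`, and dividing by `1 - K
  -- p²` adds `2 K`. The value `4 K` is the fixed point of `κ ↦ κ / 2 + 2 K`, and the excess `L²`
  -- over it is halved at each stage.
  have main : ∀ (k : ℕ) (p : ℝ), K * p ^ 2 ≤ 1 / 2 → |p| * L ≤ 2 ^ k →
      a p ≤ Real.exp ((4 * K + L ^ 2 * (1 / 2) ^ k) * p ^ 2) := by
    intro k
    induction k with
    | zero =>
      intro p hp hpL
      refine (hbase p (by simpa using hpL)).trans (Real.exp_le_exp.2 ?_)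
      have : 0 ≤ 4 * K * p ^ 2 := by positivity
      simp only [pow_zero, mul_one]
      linarith
    | succ k ih =>
      intro p hp hpL
      have h1 := ih (p / 2) (by nlinarith [mul_nonneg hK (sq_nonneg p)]) (by
        rw [abs_div, abs_two]
        rw [pow_succ] at hpL
        linarith)
      set E := Real.exp ((4 * K + L ^ 2 * (1 / 2) ^ k) * (p / 2) ^ 2) with hE
      have h2 : a (p / 2) ^ 2 ≤ E ^ 2 := pow_le_pow_left₀ (ha _) h1 2
      set t := K * p ^ 2 with ht
      have ht0 : 0 ≤ t := mul_nonneg hK (sq_nonneg p)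
      have h3 : (1 - t) * a p ≤ E ^ 2 := by linarith [hstep p]
      -- `(1 + 2t)(1 - t) ≥ 1` exactly in the range `0 ≤ t ≤ 1/2`; this is the origin of the
      -- restriction on `K p²`.
      have h4 : 1 ≤ Real.exp (2 * t) * (1 - t) := by
        have := mul_le_mul_of_nonneg_right (Real.add_one_le_exp (2 * t))
          (show 0 ≤ 1 - t by linarith)
        nlinarith
      have h5 : a p ≤ Real.exp (2 * t) * E ^ 2 := calc
        a p ≤ (Real.exp (2 * t) * (1 - t)) * a p := le_mul_of_one_le_left (ha p) h4
        _ = Real.exp (2 * t) * ((1 - t) * a p) := by ring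
        _ ≤ _ := mul_le_mul_of_nonneg_left h3 (Real.exp_nonneg _)
      refine h5.trans (le_of_eq ?_)
      rw [hE, ← Real.exp_nat_mul, ← Real.exp_add, ht, pow_succ]
      push_cast
      congr 1
      ring
  have hlim : Filter.Tendsto (fun k : ℕ => Real.exp ((4 * K + L ^ 2 * (1 / 2) ^ k) * p ^ 2))
      Filter.atTop (nhds (Real.exp ((4 * K + L ^ 2 * 0) * p ^ 2))) := by
    have h := tendsto_pow_atTop_nhds_zero_of_lt_one (r := (1 / 2 : ℝ)) (by norm_num) (by norm_num)
    exact (Real.continuous_exp.tendsto _).comp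
      (((h.const_mul _).const_add _).mul_const _)
  rw [mul_zero, add_zero] at hlim
  obtain ⟨k, hk⟩ := pow_unbounded_of_one_lt (|p| * L) (one_lt_two)
  refine ge_of_tendsto hlim (Filter.eventually_atTop.2 ⟨k, fun j hj => main j p hp ?_⟩)
  exact hk.le.trans (pow_le_pow_right₀ one_le_two hj)

/-- The sum of the series which bounds the constants of a Moser iteration. -/
def moserSum (χ L : ℝ) : ℝ := ∑' j : ℕ, χ⁻¹ ^ j * (L + j * Real.log χ)

theorem summable_moserSum {χ : ℝ} (hχ : 1 < χ) (L : ℝ) :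
    Summable fun j : ℕ => χ⁻¹ ^ j * (L + j * Real.log χ) := by
  have h0 : 0 ≤ χ⁻¹ := by positivity
  have h1 : χ⁻¹ < 1 := inv_lt_one_of_one_lt₀ hχ
  have s1 := (summable_geometric_of_lt_one h0 h1).mul_right L
  have s2 := (summable_pow_mul_geometric_of_norm_lt_one 1
    (show ‖χ⁻¹‖ < 1 by rwa [Real.norm_of_nonneg h0])).mul_right (Real.log χ)
  refine (s1.add s2).congr fun j => ?_
  ring

/-- After taking logarithms, the step from `p χ^k` to `p χ^(k+1)` costs at most `L + k log χ`, since
`1 + D p χ^k ≤ (1 + D p) χ^k`. Division by `χ^k` makes the total cost summable. -/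
theorem log_le_moserSum {J : ℝ → ℝ} {χ A D p : ℝ} (hχ : 1 < χ) (hA : 1 ≤ A) (hD : 0 ≤ D)
    (hp : 0 < p) (hJ : ∀ q, 0 < J q)
    (hstep : ∀ q, 0 < q → J (χ * q) ^ χ⁻¹ ≤ A * (1 + D * q) * J q) (k : ℕ) :
    Real.log (J (p * χ ^ k)) ≤
      χ ^ k * (Real.log (J p) + moserSum χ (Real.log (A * (1 + D * p)))) := by
  have hχ0 : 0 < χ := by linarith
  set L := Real.log (A * (1 + D * p)) with hL
  have hDp : 0 ≤ D * p := by positivity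
  have hL0 : 0 ≤ L := Real.log_nonneg (by nlinarith)
  have hlχ : 0 ≤ Real.log χ := Real.log_nonneg hχ.le
  have main : ∀ k : ℕ, Real.log (J (p * χ ^ k)) ≤
      χ ^ k * (Real.log (J p) + ∑ j ∈ Finset.range k, χ⁻¹ ^ j * (L + j * Real.log χ)) := by
    intro k
    induction k with
    | zero => simp
    | succ k ih =>
      have hχk : 1 ≤ χ ^ k := one_le_pow₀ hχ.le
      have hq : 0 < p * χ ^ k := by positivity
      have h1 := Real.log_le_log (Real.rpow_pos_of_pos (hJ _) _) (hstep _ hq)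
      have hpos : 0 < A * (1 + D * (p * χ ^ k)) := by positivity
      rw [Real.log_rpow (hJ _), Real.log_mul hpos.ne' (hJ _).ne'] at h1
      have h2 : Real.log (A * (1 + D * (p * χ ^ k))) ≤ L + k * Real.log χ := by
        rw [hL, ← Real.log_pow, ← Real.log_mul (by positivity) (by positivity)]
        refine Real.log_le_log hpos ?_
        rw [mul_assoc]
        refine mul_le_mul_of_nonneg_left ?_ (by linarith)
        nlinarith
      have h3 : Real.log (J (p * χ ^ (k + 1))) ≤
          χ * (L + k * Real.log χ + Real.log (J (p * χ ^ k))) := by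
        have h4 : Real.log (J (χ * (p * χ ^ k))) ≤
            χ * (L + k * Real.log χ + Real.log (J (p * χ ^ k))) := by
          rw [inv_mul_le_iff₀ hχ0] at h1
          exact h1.trans (mul_le_mul_of_nonneg_left (by linarith) hχ0.le)
        rwa [show χ * (p * χ ^ k) = p * χ ^ (k + 1) by ring] at h4
      refine h3.trans ((mul_le_mul_of_nonneg_left (add_le_add_right ih _) hχ0.le).trans
        (le_of_eq ?_))
      rw [Finset.sum_range_succ, inv_pow]
      field_simp
      ring
  refine (main k).trans (mul_le_mul_of_nonneg_left (add_le_add_right ?_ _) (by positivity))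
  exact (summable_moserSum hχ L).sum_le_tsum _ fun j _ => by positivity

end Growth

section Moment

variable {X : Type*} [TopologicalSpace X] [CompactSpace X] [MeasurableSpace X] [BorelSpace X]
  {μ : Measure X} [IsFiniteMeasure μ] {u : X → ℝ}

theorem integrable_of_continuous {f : X → ℝ} (hf : Continuous f) : Integrable f μ :=
  hf.integrable_of_hasCompactSupport (HasCompactSupport.of_compactSpace f)

/-- If `p u x > T`, then `p u > p t > T` on an open set of positive measure `δ`. The hypothesis then
forces `χ^k (p t - T) ≤ -log δ` for every `k`, which is absurd. -/
theorem mul_le_of_log_integral_exp_le (hμ : ∀ U : Set X, IsOpen U → U.Nonempty → 0 < μ U)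
    (hu : Continuous u) {χ p T : ℝ} (hχ : 1 < χ) (hp : 0 < p)
    (h : ∀ k : ℕ, Real.log (∫ x, Real.exp (p * χ ^ k * u x) ∂μ) ≤ χ ^ k * T) (x : X) :
    p * u x ≤ T := by
  by_contra! hx
  obtain ⟨t, ht, htx⟩ : ∃ t, T / p < t ∧ t < u x :=
    exists_between (by rwa [div_lt_iff₀ hp, mul_comm])
  rw [div_lt_iff₀ hp] at ht
  have hU : IsOpen {y | t < u y} := isOpen_lt continuous_const hu
  have hδ : 0 < μ.real {y | t < u y} :=
    ENNReal.toReal_pos (hμ _ hU ⟨x, htx⟩).ne' (measure_ne_top _ _)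
  set δ := μ.real {y | t < u y} with hδd
  have key : ∀ k : ℕ, χ ^ k ≤ -Real.log δ / (t * p - T) := by
    intro k
    have hχk : 0 < χ ^ k := pow_pos (by linarith) k
    have hpk : 0 < p * χ ^ k := by positivity
    have hint : Integrable (fun x => Real.exp (p * χ ^ k * u x)) μ :=
      integrable_of_continuous (by fun_prop)
    have h1 : δ * Real.exp (p * χ ^ k * t) ≤ ∫ x, Real.exp (p * χ ^ k * u x) ∂μ := by
      calc δ * Real.exp (p * χ ^ k * t)
          = ∫ _ in {y | t < u y}, Real.exp (p * χ ^ k * t) ∂μ := by simp [hδd]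
        _ ≤ ∫ x in {y | t < u y}, Real.exp (p * χ ^ k * u x) ∂μ := by
            refine setIntegral_mono_on (integrable_const _).integrableOn hint.integrableOn
              hU.measurableSet fun y hy => ?_
            exact Real.exp_le_exp.2 (mul_le_mul_of_nonneg_left (le_of_lt hy) hpk.le)
        _ ≤ _ := setIntegral_le_integral hint
            (Filter.Eventually.of_forall fun y => Real.exp_nonneg _)
    have h2 := (Real.log_le_log (by positivity) h1).trans (h k)
    rw [Real.log_mul hδ.ne' (Real.exp_pos _).ne', Real.log_exp] at h2
    rw [le_div_iff₀ (by linarith)]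
    linarith
  obtain ⟨k, hk⟩ := pow_unbounded_of_one_lt (-Real.log δ / (t * p - T)) hχ
  exact absurd (key k) (not_le.2 hk)

/-- The Poincaré inequality and an energy bound give a reverse Hölder inequality for the
exponential moments. -/
theorem integral_exp_le_sq {V b C p Q : ℝ} (hV : μ.real Set.univ = V) (hV0 : 0 < V) (hb : 0 ≤ b)
    (hu : Continuous u) (hQ : ∀ c, |p * Q| ≤ b * ∫ x, |Real.exp (p * u x) - c| ∂μ)
    (hC : ∀ m, m = (∫ x, Real.exp (p / 2 * u x) ∂μ) / V →
      ∫ x, (Real.exp (p / 2 * u x) - m) ^ 2 ∂μ ≤ C * ((p / 2) ^ 2 * Q)) :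
    (∫ x, Real.exp (p * u x) ∂μ) ≤ (∫ x, Real.exp (p / 2 * u x) ∂μ) ^ 2 / V +
      (|C| * b / 2) ^ 2 * p ^ 2 * ∫ x, Real.exp (p * u x) ∂μ := by
  set I := ∫ x, Real.exp (p * u x) ∂μ with hI
  set H := ∫ x, Real.exp (p / 2 * u x) ∂μ with hH
  set m := H / V with hm
  set α := |C| * b / 4 with hα
  have hα0 : 0 ≤ α := by positivity
  have hsq : ∀ x, Real.exp (p * u x) = Real.exp (p / 2 * u x) ^ 2 := fun x => by
    rw [← Real.exp_nat_mul]; push_cast; ring_nf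
  have iI : Integrable (fun x => Real.exp (p * u x)) μ := integrable_of_continuous (by fun_prop)
  have iH : Integrable (fun x => Real.exp (p / 2 * u x)) μ :=
    integrable_of_continuous (by fun_prop)
  have quad : ∀ a : ℝ, ∫ x, (Real.exp (p / 2 * u x) + a) ^ 2 ∂μ = I + 2 * a * H + a ^ 2 * V := by
    intro a
    have : ∀ x, (Real.exp (p / 2 * u x) + a) ^ 2 =
        Real.exp (p * u x) + 2 * a * Real.exp (p / 2 * u x) + a ^ 2 := fun x => by
      rw [hsq]; ring
    simp_rw [this]
    have i1 : Integrable (fun x => Real.exp (p * u x) + 2 * a * Real.exp (p / 2 * u x)) μ :=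
      iI.add (iH.const_mul _)
    rw [integral_add i1 (integrable_const _), integral_add iI (iH.const_mul _), integral_const_mul, integral_const, hV, smul_eq_mul,
      mul_comm V]
  have hmV : m * V = H := div_mul_cancel₀ _ hV0.ne'
  have hN : ∫ x, (Real.exp (p / 2 * u x) - m) ^ 2 ∂μ = I - m * H := by
    have := quad (-m)
    simp only [← sub_eq_add_neg] at this
    rw [this]
    linear_combination m * hmV
  have hN0 : 0 ≤ I - m * H := hN ▸ integral_nonneg fun x => sq_nonneg _
  have hM : ∫ x, (Real.exp (p / 2 * u x) + m) ^ 2 ∂μ = I + 3 * (m * H) := by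
    rw [quad]
    linear_combination m * hmV
  -- With `c = m²` the integrand factors as `(e^{pu/2} - m)(e^{pu/2} + m)`, so that half the
  -- variance can be absorbed on the left in the next step.
  have h1 : I - m * H ≤ |p| * α * ∫ x, |Real.exp (p * u x) - m ^ 2| ∂μ := by
    rw [← hN]
    calc ∫ x, (Real.exp (p / 2 * u x) - m) ^ 2 ∂μ ≤ C * ((p / 2) ^ 2 * Q) := hC m hm
      _ ≤ |C * ((p / 2) ^ 2 * Q)| := le_abs_self _
      _ = |C| * |p| / 4 * |p * Q| := by
          rw [show C * ((p / 2) ^ 2 * Q) = C * p / 4 * (p * Q) by ring, abs_mul, abs_div, abs_mul]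
          norm_num
      _ ≤ |C| * |p| / 4 * (b * ∫ x, |Real.exp (p * u x) - m ^ 2| ∂μ) :=
          mul_le_mul_of_nonneg_left (hQ _) (by positivity)
      _ = _ := by rw [hα]; ring
  have h2 : |p| * α * ∫ x, |Real.exp (p * u x) - m ^ 2| ∂μ ≤
      1 / 2 * (I - m * H) + 1 / 2 * (p ^ 2 * α ^ 2) * (I + 3 * (m * H)) := by
    have i1 : Integrable (fun x => (Real.exp (p / 2 * u x) - m) ^ 2) μ :=
      integrable_of_continuous (by fun_prop)
    have i2 : Integrable (fun x => (Real.exp (p / 2 * u x) + m) ^ 2) μ :=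
      integrable_of_continuous (by fun_prop)
    rw [← hN, ← hM, ← integral_const_mul, ← integral_const_mul, ← integral_const_mul,
      ← integral_add (i1.const_mul _) (i2.const_mul _)]
    refine integral_mono (integrable_of_continuous (by fun_prop))
      ((i1.const_mul _).add (i2.const_mul _)) fun x => ?_
    simp only
    rw [hsq, sq_sub_sq, abs_mul, ← sq_abs p, ← sq_abs (Real.exp (p / 2 * u x) - m),
      ← sq_abs (Real.exp (p / 2 * u x) + m)]
    nlinarith [sq_nonneg (|Real.exp (p / 2 * u x) - m| -
      |p| * α * |Real.exp (p / 2 * u x) + m|)]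
  -- Nonnegativity of the variance gives `m H ≤ I`, hence `I + 3 m H ≤ 4 I`; this is why `K` equals
  -- `4 α²`.
  have h3 : p ^ 2 * α ^ 2 * (m * H) ≤ p ^ 2 * α ^ 2 * I :=
    mul_le_mul_of_nonneg_left (by linarith) (by positivity)
  have h4 : H ^ 2 / V = m * H := by rw [hm]; ring
  have h5 : (|C| * b / 2) ^ 2 * p ^ 2 * I = 4 * (p ^ 2 * α ^ 2 * I) := by rw [hα]; ring
  rw [h4, h5]
  nlinarith

/-- The bound `L` of `|u|` exists by compactness and enters only the base case of
`le_exp_of_le_sq_half`, so it is absent from the estimate. Mean zero removes the linear term of the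
exponential there. -/
theorem integral_exp_le_of_integral_eq_zero {V b C p : ℝ} {Q : ℝ → ℝ}
    (hV : μ.real Set.univ = V) (hV0 : 0 < V) (hb : 0 ≤ b) (hu : Continuous u)
    (hu0 : ∫ x, u x ∂μ = 0)
    (hQ : ∀ p c, |p * Q p| ≤ b * ∫ x, |Real.exp (p * u x) - c| ∂μ)
    (hC : ∀ p m, m = (∫ x, Real.exp (p / 2 * u x) ∂μ) / V →
      ∫ x, (Real.exp (p / 2 * u x) - m) ^ 2 ∂μ ≤ C * ((p / 2) ^ 2 * Q p))
    (hp : (|C| * b / 2) ^ 2 * p ^ 2 ≤ 1 / 2) :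
    (∫ x, Real.exp (p * u x) ∂μ) ≤ V * Real.exp (4 * (|C| * b / 2) ^ 2 * p ^ 2) := by
  obtain ⟨L, hL⟩ := (isCompact_univ (X := X)).exists_bound_of_continuousOn hu.continuousOn
  replace hL : ∀ x, |u x| ≤ L := fun x => hL x (Set.mem_univ x)
  have key := le_exp_of_le_sq_half (a := fun p => (∫ x, Real.exp (p * u x) ∂μ) / V) (L := L)
    (sq_nonneg (|C| * b / 2))
    (fun p => div_nonneg (integral_nonneg fun x => Real.exp_nonneg _) hV0.le) ?_ ?_ hp
  · rwa [div_le_iff₀ hV0, mul_comm] at key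
  · intro p
    have h := integral_exp_le_sq hV hV0 hb hu (hQ p) (hC p)
    have h' := div_le_div_of_nonneg_right h hV0.le
    refine h'.trans (le_of_eq ?_)
    field_simp
  · intro p hp
    rw [div_le_iff₀ hV0]
    have iu : Integrable (fun x => 1 + p * u x + L ^ 2 * p ^ 2) μ :=
      integrable_of_continuous (by fun_prop)
    calc ∫ x, Real.exp (p * u x) ∂μ ≤ ∫ x, (1 + p * u x + L ^ 2 * p ^ 2) ∂μ := by
          refine integral_mono (integrable_of_continuous (by fun_prop)) iu fun x => ?_
          have hx : |p * u x| ≤ |p| * L := by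
            rw [abs_mul]
            exact mul_le_mul_of_nonneg_left (hL x) (abs_nonneg p)
          have h1 := (abs_le.1 (Real.abs_exp_sub_one_sub_id_le (hx.trans hp))).2
          have h2 : (p * u x) ^ 2 ≤ L ^ 2 * p ^ 2 := by
            rw [← sq_abs, ← sq_abs p]
            nlinarith [abs_nonneg (p * u x)]
          simp only
          linarith
      _ = (1 + L ^ 2 * p ^ 2) * V := by
          have iu' : Integrable u μ := integrable_of_continuous hu
          have i1 : Integrable (fun x => 1 + p * u x) μ := (integrable_const _).add (iu'.const_mul p)
          rw [integral_add i1 (integrable_const _),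
            integral_add (integrable_const _) (iu'.const_mul p), integral_const_mul, hu0,
            integral_const, integral_const, hV, smul_eq_mul, smul_eq_mul]
          ring
      _ ≤ Real.exp (L ^ 2 * p ^ 2) * V := by
          refine mul_le_mul_of_nonneg_right ?_ hV0.le
          linarith [Real.add_one_le_exp (L ^ 2 * p ^ 2)]

/-- The bound for functions of mean zero given by the Sobolev constant `A`, the Poincaré constant
`C`, the energy constant `b` and the volume `V`. -/
def supBound (χ b A C V : ℝ) : ℝ :=
  (1 + 2 * (|C| * b / 2) ^ 2) * (Real.log V + 4 * (|C| * b / 2) ^ 2 +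
    moserSum χ (Real.log (max |A| 1 * (1 + b / 4 * (1 + 2 * (|C| * b / 2) ^ 2)⁻¹))))

/-- One-sided and abstract in `Q`, the energy `∫ e^{pu} |du|²`, so that it applies to both `w` and
`-w`. -/
theorem le_supBound {V b A C χ : ℝ} {Q : ℝ → ℝ} (hχ : 1 < χ)
    (hμ : ∀ U : Set X, IsOpen U → U.Nonempty → 0 < μ U)
    (hV : μ.real Set.univ = V) (hV0 : 0 < V) (hb : 0 ≤ b) (hu : Continuous u)
    (hu0 : ∫ x, u x ∂μ = 0)
    (hQ : ∀ p c, |p * Q p| ≤ b * ∫ x, |Real.exp (p * u x) - c| ∂μ)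
    (hA : ∀ p, (∫ x, Real.exp (χ * p * u x) ∂μ) ^ χ⁻¹ ≤
      A * ((p / 2) ^ 2 * Q p + ∫ x, Real.exp (p * u x) ∂μ))
    (hC : ∀ p m, m = (∫ x, Real.exp (p / 2 * u x) ∂μ) / V →
      ∫ x, (Real.exp (p / 2 * u x) - m) ^ 2 ∂μ ≤ C * ((p / 2) ^ 2 * Q p)) (x : X) :
    u x ≤ supBound χ b A C V := by
  set K := (|C| * b / 2) ^ 2 with hK
  have hK0 : 0 ≤ K := sq_nonneg _
  -- A starting exponent that depends on `K` alone and satisfies `p ≤ 1` and `K p² ≤ 1/2`; its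
  -- inverse is the outer factor in `supBound`.
  set p := (1 + 2 * K)⁻¹ with hp
  have hp0 : 0 < p := by positivity
  have hp1 : p ≤ 1 := inv_le_one_of_one_le₀ (by linarith)
  have hpK : p * (1 + 2 * K) = 1 := inv_mul_cancel₀ (by positivity)
  have hKp : K * p ^ 2 ≤ 1 / 2 := by nlinarith
  have hμ0 : μ ≠ 0 := by
    rintro rfl
    simp at hV
    exact hV0.ne hV
  have : NeZero μ := ⟨hμ0⟩
  have hexp : ∀ q, Integrable (fun x => Real.exp (q * u x)) μ :=
    fun q => integrable_of_continuous (by fun_prop)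
  have hJ : ∀ q, 0 < ∫ x, Real.exp (q * u x) ∂μ := fun q => integral_exp_pos (hexp q)
  have hmoser := log_le_moserSum (J := fun q => ∫ x, Real.exp (q * u x) ∂μ) hχ
    (le_max_right |A| 1) (show 0 ≤ b / 4 by positivity) hp0 hJ (fun q hq => by
      -- With `c = 0` the energy is at most `(b / q) J(q)`, so `(q/2)² Q(q)` is at most `(b/4) q
      -- J(q)`; hence `D = b / 4`.
      have h1 := hQ q 0
      simp only [sub_zero, abs_of_pos (Real.exp_pos _), abs_mul, abs_of_pos hq] at h1
      have hJq := hJ q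
      set J := ∫ x, Real.exp (q * u x) ∂μ
      have h2 : |(q / 2) ^ 2 * Q q + J| ≤ (1 + b / 4 * q) * J := by
        refine (abs_add_le _ _).trans ?_
        rw [abs_of_pos hJq, abs_mul, abs_of_nonneg (sq_nonneg (q / 2))]
        nlinarith
      calc _ ≤ A * ((q / 2) ^ 2 * Q q + J) := hA q
        _ ≤ |A * ((q / 2) ^ 2 * Q q + J)| := le_abs_self _
        _ = |A| * |(q / 2) ^ 2 * Q q + J| := abs_mul _ _
        _ ≤ max |A| 1 * ((1 + b / 4 * q) * J) :=
          mul_le_mul (le_max_left _ _) h2 (abs_nonneg _) (by positivity)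
        _ = _ := by ring)
  have hx := mul_le_of_log_integral_exp_le hμ hu hχ hp0 hmoser x
  have hlog : Real.log (∫ x, Real.exp (p * u x) ∂μ) ≤ Real.log V + 4 * K := by
    have h := Real.log_le_log (hJ p)
      (integral_exp_le_of_integral_eq_zero hV hV0 hb hu hu0 hQ hC hKp)
    rw [Real.log_mul hV0.ne' (Real.exp_pos _).ne', Real.log_exp] at h
    refine h.trans (add_le_add_right ?_ _)
    rw [mul_assoc]
    nlinarith
  have hfin : p * u x ≤ Real.log V + 4 * K + moserSum χ (Real.log (max |A| 1 * (1 + b / 4 * p))) :=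
    hx.trans (by simpa using hlog)
  rw [supBound, ← hK, ← hp]
  calc u x = (1 + 2 * K) * (p * u x) := by linear_combination -(u x) * hpK
    _ ≤ _ := mul_le_mul_of_nonneg_left hfin (by positivity)

end Moment

namespace HermitianMetric

/-! ### The bound for Gauduchon factors -/

section Gauduchon

variable {n : ℕ} {X : Type*} [TopologicalSpace X] [ChartedSpace (Cn n) X]
  [IsManifold 𝓘(ℂ, Cn n) ω X] [MeasurableSpace X] (g : HermitianMetric n X)
  {w : X → ℝ} {CS CP : ℝ}

theorem integral_gradSq_exp_sub_const (hn : 1 ≤ n) (hw : IsSmoothFun n w) (p m : ℝ) :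
    ∫ x, g.gradSq (fun x => Real.exp (p / 2 * w x) - m) x ∂g.volume =
      (p / 2) ^ 2 * ∫ x, Real.exp (p * w x) * g.gradSq w x ∂g.volume := by
  simp_rw [g.gradSq_exp_sub_const hn hw, mul_div_cancel₀ p (two_ne_zero' ℝ)]
  rw [integral_const_mul]

/-- The Sobolev inequality for `e^{pw/2}`: the exponent `2n/(n-1)` is `2χ` with `χ = n/(n-1)`. -/
theorem IsSobolevConstant.integral_exp_le {g : HermitianMetric n X} (hS : g.IsSobolevConstant CS)
    (hn : 2 ≤ n) (hw : IsSmoothFun n w) (p : ℝ) :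
    (∫ x, Real.exp ((n : ℝ) / (n - 1) * p * w x) ∂g.volume) ^ ((n : ℝ) / (n - 1))⁻¹ ≤
      CS * ((p / 2) ^ 2 * (∫ x, Real.exp (p * w x) * g.gradSq w x ∂g.volume) +
        ∫ x, Real.exp (p * w x) ∂g.volume) := by
  have h := hS _ (isSmoothFun_exp hw (p / 2))
  have hgrad := g.integral_gradSq_exp_sub_const (by omega) hw p 0
  simp only [sub_zero] at hgrad
  rw [hgrad] at h
  have h1 : ∀ x, |Real.exp (p / 2 * w x)| ^ (2 * (n : ℝ) / (n - 1)) =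
      Real.exp ((n : ℝ) / (n - 1) * p * w x) := fun x => by
    rw [abs_of_pos (Real.exp_pos _), ← Real.exp_mul]
    ring_nf
  have h2 : ∀ x, |Real.exp (p / 2 * w x)| ^ 2 = Real.exp (p * w x) := fun x => by
    rw [abs_of_pos (Real.exp_pos _), ← Real.exp_nat_mul]
    push_cast
    ring_nf
  simp only [h1, h2] at h
  rwa [inv_div]

variable [CompactSpace X] [BorelSpace X]

theorem IsPoincareConstant.integral_exp_sub_sq_le {g : HermitianMetric n X}
    (hP : g.IsPoincareConstant CP) (hn : 1 ≤ n) (hw : IsSmoothFun n w) {V : ℝ}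
    (hV : g.volume.real Set.univ = V) (hV0 : 0 < V) (p : ℝ) {m : ℝ}
    (hm : m = (∫ x, Real.exp (p / 2 * w x) ∂g.volume) / V) :
    ∫ x, (Real.exp (p / 2 * w x) - m) ^ 2 ∂g.volume ≤
      CP * ((p / 2) ^ 2 * ∫ x, Real.exp (p * w x) * g.gradSq w x ∂g.volume) := by
  have := g.isFiniteMeasure_volume
  have hE := isSmoothFun_exp hw (p / 2)
  have h := hP (fun x => Real.exp (p / 2 * w x) - m)
    (ContDiff.comp_contMDiff (g := fun t => Real.exp (p / 2 * t) - m) (by fun_prop) hw) (by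
      rw [integral_sub (g.integrable_of_continuous (ContMDiff.continuous hE)) (integrable_const _),
        integral_const, hV, hm, smul_eq_mul, mul_div_cancel₀ _ hV0.ne', sub_self])
  simpa only [sq_abs, g.integral_gradSq_exp_sub_const hn hw p m] using h

variable [T2Space X]

/-- A function `w` of mean zero with `e^w ∈ ker Δ^*` is bounded in terms of the dimension, the
torsion, the Sobolev and Poincaré constants and the volume. -/
theorem abs_le_supBound (hn : 2 ≤ n) {B V : ℝ} (hB : g.DdcBound B) (hS : g.IsSobolevConstant CS)
    (hP : g.IsPoincareConstant CP) (hV : g.volume.real Set.univ = V) (hV0 : 0 < V)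
    (hw : IsSmoothFun n w) (hker : g.InKerLaplacianAdjoint fun x => Real.exp (w x))
    (hw0 : ∫ x, w x ∂g.volume = 0) (x : X) :
    |w x| ≤ supBound ((n : ℝ) / (n - 1)) (n * |B|) CS CP V := by
  have := g.isFiniteMeasure_volume
  have hn1 : 1 ≤ n := by omega
  have hwc : Continuous w := ContMDiff.continuous hw
  have hn2 : (2 : ℝ) ≤ n := by exact_mod_cast hn
  have hχ : 1 < (n : ℝ) / (n - 1) := by
    rw [lt_div_iff₀ (by linarith)]
    linarith
  have hopen := fun (U : Set X) (hU : IsOpen U) (hne : U.Nonempty) =>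
    g.volume_pos_of_isOpen hU hne
  have hb : 0 ≤ n * |B| := by positivity
  have hQ := g.abs_mul_integral_exp_mul_gradSq_le hn1 hw hker hB
  have hneg : ∀ q y : ℝ, q * -y = -q * y := fun q y => by ring
  refine abs_le.2 ⟨?_, ?_⟩
  -- For `-w` the energy at `p` is that of `w` at `-p`.
  · have h := le_supBound (u := fun x => -w x)
      (Q := fun p => ∫ x, Real.exp (-p * w x) * g.gradSq w x ∂g.volume) hχ hopen hV hV0 hb
      hwc.neg (by rw [integral_neg, hw0, neg_zero])
      (fun p c => by simpa only [hneg, neg_mul, abs_neg] using hQ (-p) c)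
      (fun p => by simpa only [hneg, ← mul_neg, neg_div, neg_sq] using hS.integral_exp_le hn hw (-p))
      (fun p m hm => by
        simp only [hneg, ← neg_div] at hm ⊢
        have := hP.integral_exp_sub_sq_le hn1 hw hV hV0 (-p) hm
        rwa [neg_div, neg_sq, ← neg_div] at this) x
    linarith
  · exact le_supBound (Q := fun p => ∫ x, Real.exp (p * w x) * g.gradSq w x ∂g.volume) hχ hopen hV
      hV0 hb hwc hw0 hQ (hS.integral_exp_le hn hw)
      (fun p m => hP.integral_exp_sub_sq_le hn1 hw hV hV0 p) x

theorem le_exp_supBound (hn : 2 ≤ n) {B V : ℝ} (hB : g.DdcBound B) (hS : g.IsSobolevConstant CS)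
    (hP : g.IsPoincareConstant CP) (hV : g.volume.real Set.univ = V) {ρ : X → ℝ}
    (hker : g.InKerLaplacianAdjoint ρ) (hρ : IsGLB (Set.range ρ) 1) (x : X) :
    ρ x ≤ Real.exp (2 * supBound ((n : ℝ) / (n - 1)) (n * |B|) CS CP V) := by
  have := g.isFiniteMeasure_volume
  have hV0 : 0 < V := hV ▸ ENNReal.toReal_pos
    (g.volume_pos_of_isOpen isOpen_univ ⟨x, Set.mem_univ x⟩).ne' (measure_ne_top _ _)
  have hpos : ∀ y, 0 < ρ y := fun y => one_pos.trans_le (hρ.1 ⟨y, rfl⟩)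
  have hlog : IsSmoothFun n fun y => Real.log (ρ y) := fun y =>
    ContDiffAt.comp_contMDiffAt (Real.contDiffAt_log.2 (hpos y).ne') (hker.1 y)
  set c := (∫ y, Real.log (ρ y) ∂g.volume) / V with hc
  have hw : IsSmoothFun n fun y => Real.log (ρ y) - c :=
    ContDiff.comp_contMDiff (g := fun t => t - c) (by fun_prop) hlog
  have hexp : ∀ y, Real.exp (Real.log (ρ y) - c) = Real.exp (-c) * ρ y := fun y => by
    rw [sub_eq_add_neg, Real.exp_add, Real.exp_log (hpos y), mul_comm]
  have hkw : g.InKerLaplacianAdjoint fun y => Real.exp (Real.log (ρ y) - c) := by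
    refine ⟨by simpa using isSmoothFun_exp hw 1, fun f hf => ?_⟩
    simp_rw [hexp, mul_assoc]
    rw [integral_const_mul, hker.2 f hf, mul_zero]
  have hbound := g.abs_le_supBound hn hB hS hP hV hV0 hw hkw (by
    rw [integral_sub (g.integrable_of_continuous (ContMDiff.continuous hlog)) (integrable_const _),
      integral_const, hV, smul_eq_mul, hc, mul_div_cancel₀ _ hV0.ne', sub_self])
  set M := supBound ((n : ℝ) / (n - 1)) (n * |B|) CS CP V
  -- Two values of `log ρ` differ by at most `2 M`, so `e^{log ρ(x) - 2M}` is a lower bound of `ρ`,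
  -- hence at most the infimum `1`.
  have hlow : Real.exp (Real.log (ρ x) - 2 * M) ≤ 1 := by
    refine hρ.2 ?_
    rintro _ ⟨y, rfl⟩
    rw [← Real.le_log_iff_exp_le (hpos y)]
    linarith [(abs_le.1 (hbound x)).2, (abs_le.1 (hbound y)).1]
  rw [← Real.log_le_iff_le_exp (hpos x)]
  linarith [Real.exp_le_one_iff.1 hlow]

end Gauduchon

end HermitianMetric

end GauduchonFactor

end

theorem mainTheorem3 (n : ℕ) (hn : 2 ≤ n) (B CS CP V : ℝ) :
    ∃ CG : ℝ, ∀ (X : Type*) [TopologicalSpace X] [T2Space X] [CompactSpace X]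
      [ChartedSpace (GauduchonFactor.Cn n) X]
      [IsManifold 𝓘(ℂ, GauduchonFactor.Cn n) ω X]
      [MeasurableSpace X] [BorelSpace X]
      (g : GauduchonFactor.HermitianMetric n X),
      g.DdcBound B → g.IsSobolevConstant CS → g.IsPoincareConstant CP →
      g.volume.real Set.univ = V →
      ∀ ρ : X → ℝ, g.InKerLaplacianAdjoint ρ → IsGLB (Set.range ρ) 1 →
        ∀ x : X, ρ x ≤ CG := by
  -- Unification makes the witness the exponential in `le_exp_supBound`, an expression in `n`, `B`,
  -- `CS`, `CP`, `V` only.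
  exact ⟨_, fun _ _ _ _ _ _ _ _ g hB hS hP hV _ hker hρ =>
    g.le_exp_supBound hn hB hS hP hV hker hρ⟩
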